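/- Let $k$ be a field of characteristic $\neq 2$. A dialgebra over $k$ is a $k$-linear space with two bilinear associative products $\vdash,\dashv$ such that $a\dashv(b\vdash c)=a\dashv(b\dashv c)$, $(a\dashv b)\vdash c=a\vdash(b\vdash c)$ and $a\vdash(b\dashv c)=(a\vdash b)\dashv c$. The free dialgebra $D(Y)$ on a set $Y$ has as linear basis the normal diwords $$[u]=y_{-m}\cdots y_{-1}\dot y_0y_1\cdots y_r:=y_{-m}\vdash\cdots\vdash y_{-1}\vdash y_0\dashv y_1\dashv\cdots\dashv y_r\qquad(m,r\ge 0),$$ with center $y_0$ and length $|[u]|=m+r+1$. For $Y$ well ordered, normal diwords are ordered by comparing the weights $(r+m+1,\,m,\,y_{-m},\dots,y_0,\dots,y_r)$ lexicographically. **Gröbner–Shirshov bases.** For $0\ne f\in D(Y)$ let $[\bar f]$ be the greatest normal diword in its support and $\deg f=|[\bar f]|$; $f$ is monic if the coefficient of $[\bar f]$ is $1$. Call $f$ left (right) normed if in each normal diword of its support the center is the last (first) letter. For $s\in D(Y)$ an $s$-diword $[asb]$ is an element $y_{-m}\vdash\cdots\vdash y_0\dashv\cdots\dashv y_r$ in which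 one letter $y_j$ has been replaced by $s$, with $a,b$ the words to the left and to the right of $s$; $[a[\bar s]b]$ is the normal diword obtained by replacing $y_j$ by $[\bar s]$. It is normal if $j=0$, or $j<0$ and $s$ is left normed, or $j>0$ and $s$ is right normed; a normal $[asb]$ is a left (right) normed $s$-diword if both $s$ and $[asb]$ are left (right) normed. A set $S\subset D(Y)$ of monic elements is a Gröbner–Shirshov basis in $D(Y)$ if for all $f,g\in S$: * (left multiplication) if $f$ is not right normed and $y\in Y$, then $y\dashv f$ is a linear combination of right normed $s$-diwords $[asb]$, $s\in S$, with $|[a[\bar s]b]|\le\deg(y\dashv f)$ (the empty combination if $y\dashv f=0$); * (right multiplication) if $f$ is not left normed and $y\in Y$, then $f\vdash y$ is a linear combination of left normed $s$-diwords $[asb]$, $s\in S$, with $|[a[\bar s]b]|\le\deg(f\vdash y)$ (the empty combination if $f\vdash y=0$); * (inclusion) if $[w]=[\bar f]=[a[\bar g]b]$ with $[agb]$ a normal $g$-diword, then $f-[agb]$ is trivial modulo $(S,[w])$; * (intersection) if $[w]=[[\bar f]b]=[a[\bar g]]$ with $[fb]$, $[ag]$ a normal $f$-diword and a normal $g$-diword,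 and $|[\bar f]|+|[\bar g]|>|[w]|$, then $[fb]-[ag]$ is trivial modulo $(S,[w])$. Here trivial modulo $(S,[w])$ means: equal to a linear combination of normal $s$-diwords $[a'sb']$, $s\in S$, with $[a'[\bar s]b']<[w]$, all of which are right (left) normed $s$-diwords whenever both of the two diwords whose difference is taken are right (left) normed $f$- and $g$-diwords respectively. **Theorem.** Let $(a_{ij})_{n\times n}$ be a nonzero symmetric matrix over $k$, let $X=\{x_1,\dots,x_n\}$ and order $X\cup\{e\}$ by $x_1<\dots<x_n<e$. Let $C(n,f)=D(X\cup\{e\})/\mathrm{Id}(S_1)$ be the Clifford dialgebra, where $\mathrm{Id}(S_1)$ is the ideal generated by the set $S_1$ of all the elements $$x_i\vdash x_j+x_j\dashv x_i-2a_{ij}e,\qquad e\vdash y-y,\qquad y\dashv e-y\qquad(x_i,x_j\in X,\ y\in X\cup\{e\}).$$ Let $S$ be the set of the following elements of $D(X\cup\{e\})$, where $x_i,x_j\in X$ and $y\in X\cup\{e\}$: 1. $x_i\vdash x_j+x_j\dashv x_i-2a_{ij}e$; 2. $e\vdash y-y$; 3. $y\dashv e-y$; 4. $y\dashv x_i\dashv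 x_j+y\dashv x_j\dashv x_i-2a_{ij}y$ for $i>j$; 5. $y\dashv x_i\dashv x_i-a_{ii}y$; 6. $x_i\vdash x_j\vdash y+x_j\vdash x_i\vdash y-2a_{ij}y$ for $i>j$; 7. $x_i\vdash x_i\vdash y-a_{ii}y$; 8. $x_i\vdash e-e\dashv x_i$. Then: (i) $S$ is a Gröbner–Shirshov basis of $C(n,f)$, that is, $S$ is a Gröbner–Shirshov basis in $D(X\cup\{e\})$ and $\mathrm{Id}(S)=\mathrm{Id}(S_1)$. (ii) The images in $C(n,f)$ of the normal diwords $\dot y\,x_{i_1}\cdots x_{i_q}$ with $y\in X\cup\{e\}$, $q\ge 0$ and $1\le i_1<\dots<i_q\le n$ form a $k$-linear basis of $C(n,f)$ (distinct such diwords having distinct images). -/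

import Mathlib

set_option linter.unusedSimpArgs false

/-! # Dialgebras -/

/-- The two products of a dialgebra. -/
class DialgebraOps (D : Type*) where
  vdash : D → D → D
  dashv : D → D → D

infixl:70 " ⊢ᵈ " => DialgebraOps.vdash
infixl:70 " ⊣ᵈ " => DialgebraOps.dashv

/-- A `k`-linear space with two bilinear associative products satisfying the dialgebra axioms. -/
class IsDialgebra (k D : Type*) [Field k] [AddCommGroup D] [Module k D] [DialgebraOps D] :
    Prop where
  add_vdash : ∀ a b c : D, (a + b) ⊢ᵈ c = a ⊢ᵈ c + b ⊢ᵈ c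
  vdash_add : ∀ a b c : D, a ⊢ᵈ (b + c) = a ⊢ᵈ b + a ⊢ᵈ c
  smul_vdash : ∀ (t : k) (a b : D), (t • a) ⊢ᵈ b = t • (a ⊢ᵈ b)
  vdash_smul : ∀ (t : k) (a b : D), a ⊢ᵈ (t • b) = t • (a ⊢ᵈ b)
  add_dashv : ∀ a b c : D, (a + b) ⊣ᵈ c = a ⊣ᵈ c + b ⊣ᵈ c
  dashv_add : ∀ a b c : D, a ⊣ᵈ (b + c) = a ⊣ᵈ b + a ⊣ᵈ c
  smul_dashv : ∀ (t : k) (a b : D), (t • a) ⊣ᵈ b = t • (a ⊣ᵈ b)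
  dashv_smul : ∀ (t : k) (a b : D), a ⊣ᵈ (t • b) = t • (a ⊣ᵈ b)
  vdash_assoc : ∀ a b c : D, (a ⊢ᵈ b) ⊢ᵈ c = a ⊢ᵈ (b ⊢ᵈ c)
  dashv_assoc : ∀ a b c : D, (a ⊣ᵈ b) ⊣ᵈ c = a ⊣ᵈ (b ⊣ᵈ c)
  dashv_vdash : ∀ a b c : D, a ⊣ᵈ (b ⊢ᵈ c) = a ⊣ᵈ (b ⊣ᵈ c)
  dashv_vdash' : ∀ a b c : D, (a ⊣ᵈ b) ⊢ᵈ c = a ⊢ᵈ (b ⊢ᵈ c)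
  vdash_dashv : ∀ a b c : D, a ⊢ᵈ (b ⊣ᵈ c) = (a ⊢ᵈ b) ⊣ᵈ c

/-- An ideal of a dialgebra: a subspace absorbing both products on both sides. -/
structure DialgebraIdeal (k D : Type*) [Field k] [AddCommGroup D] [Module k D]
    [DialgebraOps D] extends Submodule k D where
  vdash_mem_left : ∀ (a : D) {f : D}, f ∈ carrier → a ⊢ᵈ f ∈ carrier
  vdash_mem_right : ∀ {f : D} (a : D), f ∈ carrier → f ⊢ᵈ a ∈ carrier
  dashv_mem_left : ∀ (a : D) {f : D}, f ∈ carrier → a ⊣ᵈ f ∈ carrier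
  dashv_mem_right : ∀ {f : D} (a : D), f ∈ carrier → f ⊣ᵈ a ∈ carrier

namespace DialgebraIdeal

/-- The ideal `Id(S)` generated by `S`: the intersection of all ideals containing `S`. -/
def span (k : Type*) {D : Type*} [Field k] [AddCommGroup D] [Module k D] [DialgebraOps D]
    (S : Set D) : DialgebraIdeal k D where
  toSubmodule := ⨅ (I : DialgebraIdeal k D) (_ : S ⊆ I.carrier), I.toSubmodule
  vdash_mem_left a f hf := by
    change _ ∈ (iInf _ : Submodule k D)
    change _ ∈ (iInf _ : Submodule k D) at hf
    simp only [Submodule.mem_iInf] at hf ⊢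
    exact fun I hI => I.vdash_mem_left a (hf I hI)
  vdash_mem_right {f} a hf := by
    change _ ∈ (iInf _ : Submodule k D)
    change _ ∈ (iInf _ : Submodule k D) at hf
    simp only [Submodule.mem_iInf] at hf ⊢
    exact fun I hI => I.vdash_mem_right a (hf I hI)
  dashv_mem_left a f hf := by
    change _ ∈ (iInf _ : Submodule k D)
    change _ ∈ (iInf _ : Submodule k D) at hf
    simp only [Submodule.mem_iInf] at hf ⊢
    exact fun I hI => I.dashv_mem_left a (hf I hI)
  dashv_mem_right {f} a hf := by
    change _ ∈ (iInf _ : Submodule k D)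
    change _ ∈ (iInf _ : Submodule k D) at hf
    simp only [Submodule.mem_iInf] at hf ⊢
    exact fun I hI => I.dashv_mem_right a (hf I hI)

section Quotient

variable {k D : Type*} [Field k] [AddCommGroup D] [Module k D] [DialgebraOps D]
  [IsDialgebra k D]

set_option linter.unusedSectionVars false

/-- Products on the quotient by an ideal, induced from representatives. -/
instance quotientOps (I : DialgebraIdeal k D) : DialgebraOps (D ⧸ I.toSubmodule) where
  vdash := Quotient.map₂ (· ⊢ᵈ ·) (by
    intro a a' h b b' h'
    have h := (Submodule.quotientRel_def _).mp h
    have h' := (Submodule.quotientRel_def _).mp h'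
    refine (Submodule.quotientRel_def _).mpr ?_
    have e : a ⊢ᵈ b - a' ⊢ᵈ b' = (a - a') ⊢ᵈ b + a' ⊢ᵈ (b - b') := by
      have h1 := IsDialgebra.add_vdash (k := k) (a - a') a' b
      have h2 := IsDialgebra.vdash_add (k := k) a' (b - b') b'
      rw [sub_add_cancel] at h1 h2
      rw [h1, h2]; abel
    rw [e]
    exact I.add_mem (I.vdash_mem_right b h) (I.vdash_mem_left a' h'))
  dashv := Quotient.map₂ (· ⊣ᵈ ·) (by
    intro a a' h b b' h'
    have h := (Submodule.quotientRel_def _).mp h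
    have h' := (Submodule.quotientRel_def _).mp h'
    refine (Submodule.quotientRel_def _).mpr ?_
    have e : a ⊣ᵈ b - a' ⊣ᵈ b' = (a - a') ⊣ᵈ b + a' ⊣ᵈ (b - b') := by
      have h1 := IsDialgebra.add_dashv (k := k) (a - a') a' b
      have h2 := IsDialgebra.dashv_add (k := k) a' (b - b') b'
      rw [sub_add_cancel] at h1 h2
      rw [h1, h2]; abel
    rw [e]
    exact I.add_mem (I.dashv_mem_right b h) (I.dashv_mem_left a' h'))

theorem mk_vdash (I : DialgebraIdeal k D) (a b : D) :
    (Submodule.Quotient.mk (a ⊢ᵈ b) : D ⧸ I.toSubmodule) =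
      (Submodule.Quotient.mk a : D ⧸ I.toSubmodule) ⊢ᵈ
        (Submodule.Quotient.mk b : D ⧸ I.toSubmodule) := rfl

theorem mk_dashv (I : DialgebraIdeal k D) (a b : D) :
    (Submodule.Quotient.mk (a ⊣ᵈ b) : D ⧸ I.toSubmodule) =
      (Submodule.Quotient.mk a : D ⧸ I.toSubmodule) ⊣ᵈ
        (Submodule.Quotient.mk b : D ⧸ I.toSubmodule) := rfl

instance quotientIsDialgebra (I : DialgebraIdeal k D) :
    IsDialgebra k (D ⧸ I.toSubmodule) where
  add_vdash a b c := by
    induction a using Submodule.Quotient.induction_on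
    induction b using Submodule.Quotient.induction_on
    induction c using Submodule.Quotient.induction_on
    simp only [← mk_vdash, ← Submodule.Quotient.mk_add, IsDialgebra.add_vdash (k := k)]
  vdash_add a b c := by
    induction a using Submodule.Quotient.induction_on
    induction b using Submodule.Quotient.induction_on
    induction c using Submodule.Quotient.induction_on
    simp only [← mk_vdash, ← Submodule.Quotient.mk_add, IsDialgebra.vdash_add (k := k)]
  smul_vdash t a b := by
    induction a using Submodule.Quotient.induction_on
    induction b using Submodule.Quotient.induction_on
    simp only [← mk_vdash, ← Submodule.Quotient.mk_smul, IsDialgebra.smul_vdash (k := k)]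
  vdash_smul t a b := by
    induction a using Submodule.Quotient.induction_on
    induction b using Submodule.Quotient.induction_on
    simp only [← mk_vdash, ← Submodule.Quotient.mk_smul, IsDialgebra.vdash_smul (k := k)]
  add_dashv a b c := by
    induction a using Submodule.Quotient.induction_on
    induction b using Submodule.Quotient.induction_on
    induction c using Submodule.Quotient.induction_on
    simp only [← mk_dashv, ← Submodule.Quotient.mk_add, IsDialgebra.add_dashv (k := k)]
  dashv_add a b c := by
    induction a using Submodule.Quotient.induction_on
    induction b using Submodule.Quotient.induction_on
    induction c using Submodule.Quotient.induction_on
    simp only [← mk_dashv, ← Submodule.Quotient.mk_add, IsDialgebra.dashv_add (k := k)]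
  smul_dashv t a b := by
    induction a using Submodule.Quotient.induction_on
    induction b using Submodule.Quotient.induction_on
    simp only [← mk_dashv, ← Submodule.Quotient.mk_smul, IsDialgebra.smul_dashv (k := k)]
  dashv_smul t a b := by
    induction a using Submodule.Quotient.induction_on
    induction b using Submodule.Quotient.induction_on
    simp only [← mk_dashv, ← Submodule.Quotient.mk_smul, IsDialgebra.dashv_smul (k := k)]
  vdash_assoc a b c := by
    induction a using Submodule.Quotient.induction_on
    induction b using Submodule.Quotient.induction_on
    induction c using Submodule.Quotient.induction_on
    simp only [← mk_vdash, IsDialgebra.vdash_assoc (k := k)]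
  dashv_assoc a b c := by
    induction a using Submodule.Quotient.induction_on
    induction b using Submodule.Quotient.induction_on
    induction c using Submodule.Quotient.induction_on
    simp only [← mk_dashv, IsDialgebra.dashv_assoc (k := k)]
  dashv_vdash a b c := by
    induction a using Submodule.Quotient.induction_on
    induction b using Submodule.Quotient.induction_on
    induction c using Submodule.Quotient.induction_on
    simp only [← mk_dashv, ← mk_vdash, IsDialgebra.dashv_vdash (k := k)]
  dashv_vdash' a b c := by
    induction a using Submodule.Quotient.induction_on
    induction b using Submodule.Quotient.induction_on
    induction c using Submodule.Quotient.induction_on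
    simp only [← mk_dashv, ← mk_vdash, IsDialgebra.dashv_vdash' (k := k)]
  vdash_dashv a b c := by
    induction a using Submodule.Quotient.induction_on
    induction b using Submodule.Quotient.induction_on
    induction c using Submodule.Quotient.induction_on
    simp only [← mk_dashv, ← mk_vdash, IsDialgebra.vdash_dashv (k := k)]

end Quotient

end DialgebraIdeal

/-! # Normal diwords and the free dialgebra -/

/-- The normal diword `x₋ₘ ⋯ x₋₁ ẋ₀ x₁ ⋯ xₙ = x₋ₘ ⊢ ⋯ ⊢ x₋₁ ⊢ x₀ ⊣ x₁ ⊣ ⋯ ⊣ xₙ`, with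
`left = [x₋ₘ, …, x₋₁]`, `center = x₀` and `right = [x₁, …, xₙ]`. -/
@[ext]
structure Diword (X : Type*) where
  left : List X
  center : X
  right : List X

namespace Diword

/-- The associative word underlying a normal diword. -/
def word {X : Type*} (u : Diword X) : List X := u.left ++ u.center :: u.right

/-- The number of letters. -/
def length {X : Type*} (u : Diword X) : ℕ := u.word.length

/-- The normal diword consisting of one letter. -/
def letter {X : Type*} (x : X) : Diword X := ⟨[], x, []⟩

instance {X : Type*} : DialgebraOps (Diword X) where
  vdash u v := ⟨u.word ++ v.left, v.center, v.right⟩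
  dashv u v := ⟨u.left, u.center, u.right ++ v.word⟩

theorem vdash_assoc {X : Type*} (a b c : Diword X) : (a ⊢ᵈ b) ⊢ᵈ c = a ⊢ᵈ (b ⊢ᵈ c) := by
  simp [DialgebraOps.vdash, DialgebraOps.dashv, word]

theorem dashv_assoc {X : Type*} (a b c : Diword X) : (a ⊣ᵈ b) ⊣ᵈ c = a ⊣ᵈ (b ⊣ᵈ c) := by
  simp [DialgebraOps.vdash, DialgebraOps.dashv, word]

theorem dashv_vdash {X : Type*} (a b c : Diword X) : a ⊣ᵈ (b ⊢ᵈ c) = a ⊣ᵈ (b ⊣ᵈ c) := by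
  simp [DialgebraOps.vdash, DialgebraOps.dashv, word]

theorem dashv_vdash' {X : Type*} (a b c : Diword X) : (a ⊣ᵈ b) ⊢ᵈ c = a ⊢ᵈ (b ⊢ᵈ c) := by
  simp [DialgebraOps.vdash, DialgebraOps.dashv, word]

theorem vdash_dashv {X : Type*} (a b c : Diword X) : a ⊢ᵈ (b ⊣ᵈ c) = (a ⊢ᵈ b) ⊣ᵈ c := by
  simp [DialgebraOps.vdash, DialgebraOps.dashv, word]

/-- The weight `(n + m + 1, m, x₋ₘ, …, x₀, …, xₙ)`, in the lexicographic product. -/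
def wt {X : Type*} (u : Diword X) : ℕ ×ₗ (ℕ ×ₗ List X) :=
  toLex (u.length, toLex (u.left.length, u.word))

theorem wt_injective {X : Type*} : Function.Injective (wt (X := X)) := by
  rintro ⟨a, x, b⟩ ⟨a', x', b'⟩ h
  simp only [wt, length, word, EmbeddingLike.apply_eq_iff_eq, Prod.mk.injEq] at h
  obtain ⟨-, h1, h2⟩ := h
  obtain ⟨rfl, h3⟩ := List.append_inj h2 h1
  obtain ⟨rfl, rfl⟩ := List.cons.inj h3
  rfl

/-- The deg-lex ordering of normal diwords: weights are compared lexicographically. -/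
noncomputable instance {X : Type*} [LinearOrder X] : LinearOrder (Diword X) :=
  LinearOrder.lift' wt wt_injective

end Diword

/-- The free dialgebra `D(X)` over `k`: its linear basis is the set of normal diwords in `X`. -/
abbrev FreeDialgebra (k X : Type*) [Field k] := Diword X →₀ k

namespace FreeDialgebra

/-- The generator of `D(X)` given by a letter. -/
noncomputable def of (k : Type*) {X : Type*} [Field k] (x : X) : FreeDialgebra k X :=
  Finsupp.single (Diword.letter x) 1

noncomputable instance (k X : Type*) [Field k] : DialgebraOps (FreeDialgebra k X) where
  vdash f g := f.sum fun u s => g.sum fun v t => Finsupp.single (u ⊢ᵈ v) (s * t)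
  dashv f g := f.sum fun u s => g.sum fun v t => Finsupp.single (u ⊣ᵈ v) (s * t)

section

variable {k X : Type*} [Field k]

theorem single_vdash_single (u v : Diword X) (s t : k) :
    (Finsupp.single u s : FreeDialgebra k X) ⊢ᵈ (Finsupp.single v t : FreeDialgebra k X) =
      Finsupp.single (u ⊢ᵈ v) (s * t) := by
  simp [DialgebraOps.vdash]

theorem single_dashv_single (u v : Diword X) (s t : k) :
    (Finsupp.single u s : FreeDialgebra k X) ⊣ᵈ (Finsupp.single v t : FreeDialgebra k X) =
      Finsupp.single (u ⊣ᵈ v) (s * t) := by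
  simp [DialgebraOps.dashv]

theorem add_vdash (f g h : FreeDialgebra k X) : (f + g) ⊢ᵈ h = f ⊢ᵈ h + g ⊢ᵈ h := by
  classical
  refine Finsupp.sum_add_index' (by simp) ?_
  intro u s t
  simp [add_mul, Finsupp.sum_add]

theorem vdash_add (f g h : FreeDialgebra k X) : f ⊢ᵈ (g + h) = f ⊢ᵈ g + f ⊢ᵈ h := by
  classical
  refine Eq.trans ?_ Finsupp.sum_add
  refine Finsupp.sum_congr fun u _ => ?_
  exact Finsupp.sum_add_index' (by simp) (by simp [mul_add])

theorem add_dashv (f g h : FreeDialgebra k X) : (f + g) ⊣ᵈ h = f ⊣ᵈ h + g ⊣ᵈ h := by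
  classical
  refine Finsupp.sum_add_index' (by simp) ?_
  intro u s t
  simp [add_mul, Finsupp.sum_add]

theorem dashv_add (f g h : FreeDialgebra k X) : f ⊣ᵈ (g + h) = f ⊣ᵈ g + f ⊣ᵈ h := by
  classical
  refine Eq.trans ?_ Finsupp.sum_add
  refine Finsupp.sum_congr fun u _ => ?_
  exact Finsupp.sum_add_index' (by simp) (by simp [mul_add])

theorem zero_vdash (g : FreeDialgebra k X) : (0 : FreeDialgebra k X) ⊢ᵈ g = 0 :=
  Finsupp.sum_zero_index

theorem zero_dashv (g : FreeDialgebra k X) : (0 : FreeDialgebra k X) ⊣ᵈ g = 0 :=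
  Finsupp.sum_zero_index

theorem vdash_zero (f : FreeDialgebra k X) : f ⊢ᵈ (0 : FreeDialgebra k X) = 0 := by
  simp [DialgebraOps.vdash]

theorem dashv_zero (f : FreeDialgebra k X) : f ⊣ᵈ (0 : FreeDialgebra k X) = 0 := by
  simp [DialgebraOps.dashv]

theorem smul_vdash (t : k) (f g : FreeDialgebra k X) : (t • f) ⊢ᵈ g = t • (f ⊢ᵈ g) := by
  induction f using Finsupp.induction_linear with
  | zero => simp [zero_vdash]
  | add f f' hf hf' => simp only [smul_add, add_vdash, hf, hf']
  | single u s =>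
    induction g using Finsupp.induction_linear with
    | zero => simp [vdash_zero]
    | add g g' hg hg' => simp only [smul_add, vdash_add, hg, hg']
    | single v r => simp only [Finsupp.smul_single, single_vdash_single, smul_eq_mul, mul_assoc]

theorem vdash_smul (t : k) (f g : FreeDialgebra k X) : f ⊢ᵈ (t • g) = t • (f ⊢ᵈ g) := by
  induction f using Finsupp.induction_linear with
  | zero => simp [zero_vdash]
  | add f f' hf hf' => simp only [smul_add, add_vdash, hf, hf']
  | single u s =>
    induction g using Finsupp.induction_linear with
    | zero => simp [vdash_zero]
    | add g g' hg hg' => simp only [smul_add, vdash_add, hg, hg']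
    | single v r =>
      simp only [Finsupp.smul_single, single_vdash_single, smul_eq_mul, mul_left_comm]

theorem smul_dashv (t : k) (f g : FreeDialgebra k X) : (t • f) ⊣ᵈ g = t • (f ⊣ᵈ g) := by
  induction f using Finsupp.induction_linear with
  | zero => simp [zero_dashv]
  | add f f' hf hf' => simp only [smul_add, add_dashv, hf, hf']
  | single u s =>
    induction g using Finsupp.induction_linear with
    | zero => simp [dashv_zero]
    | add g g' hg hg' => simp only [smul_add, dashv_add, hg, hg']
    | single v r => simp only [Finsupp.smul_single, single_dashv_single, smul_eq_mul, mul_assoc]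

theorem dashv_smul (t : k) (f g : FreeDialgebra k X) : f ⊣ᵈ (t • g) = t • (f ⊣ᵈ g) := by
  induction f using Finsupp.induction_linear with
  | zero => simp [zero_dashv]
  | add f f' hf hf' => simp only [smul_add, add_dashv, hf, hf']
  | single u s =>
    induction g using Finsupp.induction_linear with
    | zero => simp [dashv_zero]
    | add g g' hg hg' => simp only [smul_add, dashv_add, hg, hg']
    | single v r =>
      simp only [Finsupp.smul_single, single_dashv_single, smul_eq_mul, mul_left_comm]

/-- Two trilinear expressions agree if they agree on normal diwords. -/
theorem trilinear_ext {F G : FreeDialgebra k X → FreeDialgebra k X → FreeDialgebra k X →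
      FreeDialgebra k X}
    (hF1 : ∀ a a' b c, F (a + a') b c = F a b c + F a' b c)
    (hF2 : ∀ a b b' c, F a (b + b') c = F a b c + F a b' c)
    (hF3 : ∀ a b c c', F a b (c + c') = F a b c + F a b c')
    (hG1 : ∀ a a' b c, G (a + a') b c = G a b c + G a' b c)
    (hG2 : ∀ a b b' c, G a (b + b') c = G a b c + G a b' c)
    (hG3 : ∀ a b c c', G a b (c + c') = G a b c + G a b c')
    (h : ∀ u v w r s t, F (Finsupp.single u r) (Finsupp.single v s) (Finsupp.single w t) =
      G (Finsupp.single u r) (Finsupp.single v s) (Finsupp.single w t)) (a b c) :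
    F a b c = G a b c := by
  have z : ∀ {x : FreeDialgebra k X}, x = x + x → x = 0 := fun h => by simpa using h
  induction a using Finsupp.induction_linear with
  | zero =>
    rw [z (x := F 0 b c) (by rw [← hF1, add_zero]), z (x := G 0 b c) (by rw [← hG1, add_zero])]
  | add a a' ha ha' => rw [hF1, hG1, ha, ha']
  | single u r =>
    induction b using Finsupp.induction_linear with
    | zero =>
      rw [z (x := F _ 0 c) (by rw [← hF2, add_zero]), z (x := G _ 0 c) (by rw [← hG2, add_zero])]
    | add b b' hb hb' => rw [hF2, hG2, hb, hb']
    | single v s =>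
      induction c using Finsupp.induction_linear with
      | zero =>
        rw [z (x := F _ _ 0) (by rw [← hF3, add_zero]),
          z (x := G _ _ 0) (by rw [← hG3, add_zero])]
      | add c c' hc hc' => rw [hF3, hG3, hc, hc']
      | single w t => exact h u v w r s t

end

instance (k X : Type*) [Field k] : IsDialgebra k (FreeDialgebra k X) where
  add_vdash := add_vdash
  vdash_add := vdash_add
  smul_vdash := smul_vdash
  vdash_smul := vdash_smul
  add_dashv := add_dashv
  dashv_add := dashv_add
  smul_dashv := smul_dashv
  dashv_smul := dashv_smul
  vdash_assoc := by
    refine trilinear_ext (F := fun a b c => (a ⊢ᵈ b) ⊢ᵈ c) (G := fun a b c => a ⊢ᵈ (b ⊢ᵈ c))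
      ?_ ?_ ?_ ?_ ?_ ?_ ?_ <;> intros <;>
      simp only [add_vdash, vdash_add, add_dashv, dashv_add, single_vdash_single,
        single_dashv_single, mul_assoc, Diword.vdash_assoc]
  dashv_assoc := by
    refine trilinear_ext (F := fun a b c => (a ⊣ᵈ b) ⊣ᵈ c) (G := fun a b c => a ⊣ᵈ (b ⊣ᵈ c))
      ?_ ?_ ?_ ?_ ?_ ?_ ?_ <;> intros <;>
      simp only [add_vdash, vdash_add, add_dashv, dashv_add, single_vdash_single,
        single_dashv_single, mul_assoc, Diword.dashv_assoc]
  dashv_vdash := by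
    refine trilinear_ext (F := fun a b c => a ⊣ᵈ (b ⊢ᵈ c)) (G := fun a b c => a ⊣ᵈ (b ⊣ᵈ c))
      ?_ ?_ ?_ ?_ ?_ ?_ ?_ <;> intros <;>
      simp only [add_vdash, vdash_add, add_dashv, dashv_add, single_vdash_single,
        single_dashv_single, mul_assoc, Diword.dashv_vdash]
  dashv_vdash' := by
    refine trilinear_ext (F := fun a b c => (a ⊣ᵈ b) ⊢ᵈ c) (G := fun a b c => a ⊢ᵈ (b ⊢ᵈ c))
      ?_ ?_ ?_ ?_ ?_ ?_ ?_ <;> intros <;>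
      simp only [add_vdash, vdash_add, add_dashv, dashv_add, single_vdash_single,
        single_dashv_single, mul_assoc, Diword.dashv_vdash']
  vdash_dashv := by
    refine trilinear_ext (F := fun a b c => a ⊢ᵈ (b ⊣ᵈ c)) (G := fun a b c => (a ⊢ᵈ b) ⊣ᵈ c)
      ?_ ?_ ?_ ?_ ?_ ?_ ?_ <;> intros <;>
      simp only [add_vdash, vdash_add, add_dashv, dashv_add, single_vdash_single,
        single_dashv_single, mul_assoc, Diword.vdash_dashv]

end FreeDialgebra

/-- The image of a normal diword under a map of the letters into a dialgebra. -/
def Diword.map {X D : Type*} [DialgebraOps D] (φ : X → D) (u : Diword X) : D :=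
  u.left.foldr (fun x g => φ x ⊢ᵈ g) (u.right.foldl (fun g x => g ⊣ᵈ φ x) (φ u.center))

/-- The universal property: each map of the letters into a dialgebra extends uniquely to a
homomorphism on `D(X)`. -/
theorem FreeDialgebra.existsUnique_lift {k X D : Type*} [Field k] [AddCommGroup D] [Module k D]
    [DialgebraOps D] [IsDialgebra k D] (φ : X → D) :
    ∃! F : FreeDialgebra k X →ₗ[k] D,
      (∀ f g, F (f ⊢ᵈ g) = F f ⊢ᵈ F g) ∧ (∀ f g, F (f ⊣ᵈ g) = F f ⊣ᵈ F g) ∧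
      ∀ x, F (FreeDialgebra.of k x) = φ x := by
  have A1 := IsDialgebra.vdash_assoc (k := k) (D := D)
  have A2 := IsDialgebra.dashv_assoc (k := k) (D := D)
  have A3 := IsDialgebra.dashv_vdash (k := k) (D := D)
  have A4 := IsDialgebra.dashv_vdash' (k := k) (D := D)
  have A5 := IsDialgebra.vdash_dashv (k := k) (D := D)
  -- moving one factor through the two kinds of products of letters
  have L1 : ∀ (l : List X) (d c : D), (l.foldr (fun x g => φ x ⊢ᵈ g) d) ⊢ᵈ c =
      l.foldr (fun x g => φ x ⊢ᵈ g) (d ⊢ᵈ c) := by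
    intro l d c; induction l with
    | nil => rfl
    | cons x l ih => simp only [List.foldr_cons, A1, ih]
  have L2 : ∀ (l : List X) (d c : D), (l.foldr (fun x g => φ x ⊢ᵈ g) d) ⊣ᵈ c =
      l.foldr (fun x g => φ x ⊢ᵈ g) (d ⊣ᵈ c) := by
    intro l d c; induction l with
    | nil => rfl
    | cons x l ih => simp only [List.foldr_cons, ← A5, ih]
  have R1 : ∀ (l : List X) (d c : D), c ⊣ᵈ (l.foldl (fun g x => g ⊣ᵈ φ x) d) =
      l.foldl (fun g x => g ⊣ᵈ φ x) (c ⊣ᵈ d) := by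
    intro l; induction l with
    | nil => intro d c; rfl
    | cons x l ih => intro d c; simp only [List.foldl_cons, ih, A2]
  have L3 : ∀ (l : List X) (d c : D), (l.foldl (fun g x => g ⊣ᵈ φ x) d) ⊢ᵈ c =
      d ⊢ᵈ l.foldr (fun x g => φ x ⊢ᵈ g) c := by
    intro l; induction l with
    | nil => intro d c; rfl
    | cons x l ih => intro d c; simp only [List.foldl_cons, List.foldr_cons, ih, A4]
  have R3 : ∀ (l : List X) (d c : D), c ⊣ᵈ (l.foldr (fun x g => φ x ⊢ᵈ g) d) =
      (l.foldl (fun g x => g ⊣ᵈ φ x) c) ⊣ᵈ d := by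
    intro l; induction l with
    | nil => intro d c; rfl
    | cons x l ih => intro d c; rw [List.foldr_cons, A3, ← A2, ih, List.foldl_cons]
  have V : ∀ u v : Diword X, (u ⊢ᵈ v).map φ = u.map φ ⊢ᵈ v.map φ := by
    intro u v
    change (Diword.mk (u.word ++ v.left) v.center v.right).map φ = _
    simp only [Diword.map, Diword.word, L1, L3, List.foldr_append, List.foldr_cons]
  have W : ∀ u v : Diword X, (u ⊣ᵈ v).map φ = u.map φ ⊣ᵈ v.map φ := by
    intro u v
    change (Diword.mk u.left u.center (u.right ++ v.word)).map φ = _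
    simp only [Diword.map, Diword.word, L2, R3, R1, List.foldl_append, List.foldl_cons]
  have z1 : ∀ c : D, (0 : D) ⊢ᵈ c = 0 := fun c => by
    simpa using IsDialgebra.smul_vdash (0 : k) (0 : D) c
  have z2 : ∀ c : D, c ⊢ᵈ (0 : D) = 0 := fun c => by
    simpa using IsDialgebra.vdash_smul (0 : k) c (0 : D)
  have z3 : ∀ c : D, (0 : D) ⊣ᵈ c = 0 := fun c => by
    simpa using IsDialgebra.smul_dashv (0 : k) (0 : D) c
  have z4 : ∀ c : D, c ⊣ᵈ (0 : D) = 0 := fun c => by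
    simpa using IsDialgebra.dashv_smul (0 : k) c (0 : D)
  refine ⟨Finsupp.lift D k (Diword X) (Diword.map φ), ⟨?_, ?_, ?_⟩, ?_⟩
  · intro f g
    induction f using Finsupp.induction_linear with
    | zero => simp only [FreeDialgebra.zero_vdash, map_zero, z1]
    | add f f' hf hf' =>
      simp only [FreeDialgebra.add_vdash, map_add, hf, hf', IsDialgebra.add_vdash (k := k)]
    | single u s =>
      induction g using Finsupp.induction_linear with
      | zero => simp only [FreeDialgebra.vdash_zero, map_zero, z2]
      | add g g' hg hg' =>
        simp only [FreeDialgebra.vdash_add, map_add, hg, hg', IsDialgebra.vdash_add (k := k)]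
      | single v t =>
        rw [FreeDialgebra.single_vdash_single]
        simp only [Finsupp.lift_apply, Finsupp.sum_single_index, zero_smul, V,
          IsDialgebra.vdash_smul (k := k), IsDialgebra.smul_vdash (k := k), mul_smul, smul_comm s t]
  · intro f g
    induction f using Finsupp.induction_linear with
    | zero => simp only [FreeDialgebra.zero_dashv, map_zero, z3]
    | add f f' hf hf' =>
      simp only [FreeDialgebra.add_dashv, map_add, hf, hf', IsDialgebra.add_dashv (k := k)]
    | single u s =>
      induction g using Finsupp.induction_linear with
      | zero => simp only [FreeDialgebra.dashv_zero, map_zero, z4]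
      | add g g' hg hg' =>
        simp only [FreeDialgebra.dashv_add, map_add, hg, hg', IsDialgebra.dashv_add (k := k)]
      | single v t =>
        rw [FreeDialgebra.single_dashv_single]
        simp only [Finsupp.lift_apply, Finsupp.sum_single_index, zero_smul, W,
          IsDialgebra.dashv_smul (k := k), IsDialgebra.smul_dashv (k := k), mul_smul, smul_comm s t]
  · intro x
    simp [FreeDialgebra.of, Diword.map, Diword.letter]
  · rintro F ⟨h1, h2, h3⟩
    refine Finsupp.lhom_ext' fun u => LinearMap.ext_ring ?_
    have key : F (Finsupp.single u 1) = u.map φ := by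
      obtain ⟨a, c, b⟩ := u
      have base : ∀ (b : List X), F (Finsupp.single ⟨[], c, b⟩ 1) =
          b.foldl (fun g x => g ⊣ᵈ φ x) (φ c) := by
        intro b
        induction b using List.reverseRecOn with
        | nil => exact h3 c
        | append_singleton b x ih =>
          have e : (Finsupp.single ⟨[], c, b ++ [x]⟩ 1 : FreeDialgebra k X) =
              (Finsupp.single ⟨[], c, b⟩ 1 : FreeDialgebra k X) ⊣ᵈ FreeDialgebra.of k x := by
            rw [FreeDialgebra.of, FreeDialgebra.single_dashv_single, mul_one]; rfl
          rw [e, h2, ih, h3]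
          simp only [List.foldl_append, List.foldl_cons, List.foldl_nil]
      induction a with
      | nil => exact base b
      | cons x a ih =>
        have e : (Finsupp.single ⟨x :: a, c, b⟩ 1 : FreeDialgebra k X) =
            FreeDialgebra.of k x ⊢ᵈ (Finsupp.single ⟨a, c, b⟩ 1 : FreeDialgebra k X) := by
          rw [FreeDialgebra.of, FreeDialgebra.single_vdash_single, mul_one]; rfl
        rw [e, h1, ih, h3]
        rfl
    simpa using key

/-- The dialgebra `D(X | R) = D(X) / Id(R)` with generators `X` and defining relations `R`. -/
abbrev PresentedDialgebra {k X : Type*} [Field k] (R : Set (FreeDialgebra k X)) :=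
  FreeDialgebra k X ⧸ (DialgebraIdeal.span k R).toSubmodule

/-! # Gröbner–Shirshov bases in the free dialgebra -/

/-- The position of the letter replaced by `s` in an `s`-diword
`[asb] = x₋ₘ ⊢ ⋯ ⊢ x₋₁ ⊢ x₀ ⊣ x₁ ⊣ ⋯ ⊣ xₙ` with `xⱼ ↦ s`, together with the other letters.
* `mid a b` is `j = 0`, i.e. `[a ṡ b]`;
* `pre a u` is `j < 0`, i.e. `[a s u]` with the center of `u` as center;
* `post u b` is `j > 0`, i.e. `[u s b]` with the center of `u` as center. -/
inductive DiContext (X : Type*) where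
  | mid (a b : List X)
  | pre (a : List X) (u : Diword X)
  | post (u : Diword X) (b : List X)

namespace FreeDialgebra

section

variable {k X : Type*} [Field k]

/-- `a₁ ⊢ ⋯ ⊢ aₚ ⊢ f`, for a word `a = a₁ ⋯ aₚ`. -/
noncomputable def wordVdash (a : List X) (f : FreeDialgebra k X) : FreeDialgebra k X :=
  a.foldr (fun x g => of k x ⊢ᵈ g) f

/-- `f ⊣ b₁ ⊣ ⋯ ⊣ b_q`, for a word `b = b₁ ⋯ b_q`. -/
noncomputable def dashvWord (f : FreeDialgebra k X) (b : List X) : FreeDialgebra k X :=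
  b.foldl (fun g x => g ⊣ᵈ of k x) f

/-- `f` is left normed: every normal diword in its support is of the form `u ẋ`. -/
def LeftNormed (f : FreeDialgebra k X) : Prop := ∀ u ∈ f.support, u.right = []

/-- `f` is right normed: every normal diword in its support is of the form `ẋ u`. -/
def RightNormed (f : FreeDialgebra k X) : Prop := ∀ u ∈ f.support, u.left = []

/-- `u` is the leading term of `f`: the greatest normal diword in the support of `f`. -/
def IsLeadingTerm [LinearOrder X] (f : FreeDialgebra k X) (u : Diword X) : Prop :=
  u ∈ f.support ∧ ∀ v ∈ f.support, v ≤ u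

/-- `f` is nonzero and its leading coefficient is `1`. -/
def Monic [LinearOrder X] (f : FreeDialgebra k X) : Prop := ∃ u, IsLeadingTerm f u ∧ f u = 1

end

end FreeDialgebra

namespace DiContext

open FreeDialgebra

section

variable {k X : Type*} [Field k]

/-- The `s`-diword `[asb]` as an element of `D(X)`. -/
noncomputable def eval : DiContext X → FreeDialgebra k X → FreeDialgebra k X
  | mid a b, s => dashvWord (wordVdash a s) b
  | pre a u, s => wordVdash a (s ⊢ᵈ (Finsupp.single u 1 : FreeDialgebra k X))
  | post u b, s => dashvWord ((Finsupp.single u 1 : FreeDialgebra k X) ⊣ᵈ s) b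

/-- The normal diword `[a[v]b]`. -/
def plug : DiContext X → Diword X → Diword X
  | mid a b, v => ⟨a ++ v.left, v.center, v.right ++ b⟩
  | pre a u, v => ⟨a ++ v.word ++ u.left, u.center, u.right⟩
  | post u b, v => ⟨u.left, u.center, u.right ++ v.word ++ b⟩

/-- The word `a` of `[asb]`. -/
def leftWord : DiContext X → List X
  | mid a _ => a
  | pre a _ => a
  | post u _ => u.word

/-- The word `b` of `[asb]`. -/
def rightWord : DiContext X → List X
  | mid _ b => b
  | pre _ u => u.word
  | post _ b => b

/-- `[asb]` is a normal `s`-diword. -/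
def Normal : DiContext X → FreeDialgebra k X → Prop
  | mid _ _, _ => True
  | pre _ _, s => LeftNormed s
  | post _ _, s => RightNormed s

/-- `[asb]` is a left normed `s`-diword. -/
def LeftNormedDiword (c : DiContext X) (s : FreeDialgebra k X) : Prop :=
  c.Normal s ∧ LeftNormed s ∧ LeftNormed (c.eval s)

/-- `[asb]` is a right normed `s`-diword. -/
def RightNormedDiword (c : DiContext X) (s : FreeDialgebra k X) : Prop :=
  c.Normal s ∧ RightNormed s ∧ RightNormed (c.eval s)

end

end DiContext

namespace FreeDialgebra

section

variable {k X : Type*} [Field k] [LinearOrder X]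

/-- `h` is a finite linear combination of `S`-diwords `[asb]`, `s ∈ S`, such that
`P [asb] [a[s̄]b]` holds for each of them. -/
def IsCombination (S : Set (FreeDialgebra k X))
    (P : DiContext X → FreeDialgebra k X → Diword X → Prop) (h : FreeDialgebra k X) : Prop :=
  h ∈ Submodule.span k {g | ∃ s ∈ S, ∃ (c : DiContext X) (v : Diword X),
    IsLeadingTerm s v ∧ P c s (c.plug v) ∧ g = c.eval s}

/-- Triviality modulo `S` of a composition `h = x ⊣ f` of left multiplication.
(The zero composition is the empty combination.) -/
def LeftMulTrivial (S : Set (FreeDialgebra k X)) (h : FreeDialgebra k X) : Prop :=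
  IsCombination S (fun c s v => c.RightNormedDiword s ∧
    ∃ u, IsLeadingTerm h u ∧ v.length ≤ u.length) h

/-- Triviality modulo `S` of a composition `h = f ⊢ x` of right multiplication. -/
def RightMulTrivial (S : Set (FreeDialgebra k X)) (h : FreeDialgebra k X) : Prop :=
  IsCombination S (fun c s v => c.LeftNormedDiword s ∧
    ∃ u, IsLeadingTerm h u ∧ v.length ≤ u.length) h

/-- Triviality modulo `(S, [w])` of the composition `[a₁fb₁] - [a₂gb₂]` of inclusion or
intersection, `[a₁fb₁]` and `[a₂gb₂]` being given by the contexts `c` and `d`. -/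
def CompositionTrivial (S : Set (FreeDialgebra k X)) (w : Diword X)
    (c : DiContext X) (f : FreeDialgebra k X) (d : DiContext X) (g : FreeDialgebra k X) : Prop :=
  IsCombination S (fun e s v => e.Normal s ∧ v < w ∧
    (c.RightNormedDiword f → d.RightNormedDiword g → e.RightNormedDiword s) ∧
    (c.LeftNormedDiword f → d.LeftNormedDiword g → e.LeftNormedDiword s))
    (c.eval f - d.eval g)

/-- `S` is a Gröbner–Shirshov basis in `D(X)`: `S` is monic and all compositions of its
elements are trivial. -/
structure IsGroebnerShirshovBasis (S : Set (FreeDialgebra k X)) : Prop where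
  monic : ∀ f ∈ S, Monic f
  left_mul : ∀ f ∈ S, ¬ RightNormed f → ∀ x : X, LeftMulTrivial S (of k x ⊣ᵈ f)
  right_mul : ∀ f ∈ S, ¬ LeftNormed f → ∀ x : X, RightMulTrivial S (f ⊢ᵈ of k x)
  /-- `[w] = [f̄] = [a[ḡ]b]` with `[agb]` normal. -/
  inclusion : ∀ f ∈ S, ∀ g ∈ S, ∀ (u v w : Diword X) (d : DiContext X),
    IsLeadingTerm f u → IsLeadingTerm g v → d.Normal g → w = u → w = d.plug v →
    CompositionTrivial S w (DiContext.mid [] []) f d g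
  /-- `[w] = [[f̄]b] = [a[ḡ]]` with `[fb]`, `[ag]` normal and `|f̄| + |ḡ| > |w|`. -/
  intersection : ∀ f ∈ S, ∀ g ∈ S, ∀ (u v w : Diword X) (c d : DiContext X),
    IsLeadingTerm f u → IsLeadingTerm g v →
    c.leftWord = [] → d.rightWord = [] → c.Normal f → d.Normal g →
    w = c.plug u → w = d.plug v → w.length < u.length + v.length →
    CompositionTrivial S w c f d g

end

end FreeDialgebra

/-! # The Clifford dialgebra

The generating set `X ∪ {e}`, ordered by `x₁ < ⋯ < xₙ < e`, is `WithTop (Fin n)`, with `e = ⊤`. -/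

namespace CliffordDialgebra

open FreeDialgebra

section

variable {k : Type*} [Field k] {n : ℕ}

/-- The generator `x_i`. -/
noncomputable def x (k : Type*) [Field k] {n : ℕ} (i : Fin n) :
    FreeDialgebra k (WithTop (Fin n)) := of k (i : WithTop (Fin n))

/-- The generator `e`. -/
noncomputable def e (k : Type*) [Field k] (n : ℕ) : FreeDialgebra k (WithTop (Fin n)) :=
  of k (⊤ : WithTop (Fin n))

/-- The defining relations of the Clifford dialgebra. -/
inductive DefRel (A : Matrix (Fin n) (Fin n) k) : FreeDialgebra k (WithTop (Fin n)) → Prop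
  | r1 (i j : Fin n) :
      DefRel A (x k i ⊢ᵈ x k j + x k j ⊣ᵈ x k i - (2 * A i j) • e k n)
  | r2 (y : WithTop (Fin n)) : DefRel A (e k n ⊢ᵈ of k y - of k y)
  | r3 (y : WithTop (Fin n)) : DefRel A (of k y ⊣ᵈ e k n - of k y)

/-- The relations forming the set `S`. -/
inductive GSRel (A : Matrix (Fin n) (Fin n) k) : FreeDialgebra k (WithTop (Fin n)) → Prop
  | r1 (i j : Fin n) :
      GSRel A (x k i ⊢ᵈ x k j + x k j ⊣ᵈ x k i - (2 * A i j) • e k n)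
  | r2 (y : WithTop (Fin n)) : GSRel A (e k n ⊢ᵈ of k y - of k y)
  | r3 (y : WithTop (Fin n)) : GSRel A (of k y ⊣ᵈ e k n - of k y)
  | r4 (y : WithTop (Fin n)) (i j : Fin n) (hij : j < i) :
      GSRel A (of k y ⊣ᵈ x k i ⊣ᵈ x k j + of k y ⊣ᵈ x k j ⊣ᵈ x k i - (2 * A i j) • of k y)
  | r5 (y : WithTop (Fin n)) (i : Fin n) :
      GSRel A (of k y ⊣ᵈ x k i ⊣ᵈ x k i - A i i • of k y)
  | r6 (y : WithTop (Fin n)) (i j : Fin n) (hij : j < i) :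
      GSRel A (x k i ⊢ᵈ x k j ⊢ᵈ of k y + x k j ⊢ᵈ x k i ⊢ᵈ of k y - (2 * A i j) • of k y)
  | r7 (y : WithTop (Fin n)) (i : Fin n) :
      GSRel A (x k i ⊢ᵈ x k i ⊢ᵈ of k y - A i i • of k y)
  | r8 (i : Fin n) : GSRel A (x k i ⊢ᵈ e k n - e k n ⊣ᵈ x k i)

/-- The set of defining relations of the Clifford dialgebra. -/
def defRelations (A : Matrix (Fin n) (Fin n) k) : Set (FreeDialgebra k (WithTop (Fin n))) :=
  {f | DefRel A f}

/-- The set `S` of these relations. -/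
def gsRelations (A : Matrix (Fin n) (Fin n) k) : Set (FreeDialgebra k (WithTop (Fin n))) :=
  {f | GSRel A f}

end

/-- The normal diwords `ẏ x_{i₁} ⋯ x_{i_q}` with `y ∈ X ∪ {e}`, `i₁ < ⋯ < i_q`, `q ≥ 0`. -/
def basisDiwords (n : ℕ) : Set (Diword (WithTop (Fin n))) :=
  {u | ∃ (y : WithTop (Fin n)) (l : List (Fin n)), l.Pairwise (· < ·) ∧
    u = ⟨[], y, l.map (fun i => (i : WithTop (Fin n)))⟩}

end CliffordDialgebra

/-- The Clifford dialgebra `C(n, f)` of a matrix `A` over `k`. -/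
abbrev CliffordDialgebra {k : Type*} [Field k] {n : ℕ} (A : Matrix (Fin n) (Fin n) k) :=
  PresentedDialgebra (CliffordDialgebra.defRelations A)

/-! No composition is computed. A concrete dialgebra satisfying the relations detects which
combinations of diwords vanish, and triviality of every composition follows from that.

The model is the bimodule `V ⊗ Cl`, where `Cl` is the Clifford algebra of `A` and `V` has basis `x₁,
…, xₙ, e`. A bimodule map `proj` to `Cl` makes it a dialgebra: `a ⊢ b = proj(a) b` and `a ⊣ b = a
proj(b)`. The relations in `S₁` hold there (`letter_vdash_letter`, `top_vdash`, `dashv_top`), so the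
induced map `hom` kills `Id(S₁)`. It sends `ẏ x_{i₁} ⋯ x_{i_q}` with increasing indices to `y ⊗
x_{i₁} ⋯ x_{i_q}`. These images are independent because the increasing products are independent in
`Cl` (`linearIndependent_prod_gen`, by passing to the exterior algebra).

Conversely, every diword not of this form is the leading term of a normal `S`-diword
(`exists_normal_rule`). Reducing an element of the kernel of `hom` therefore leaves an irreducible
remainder that is again in the kernel, hence zero (`mem_span_of_map_eq_zero`). So the element is a
combination of normal `S`-diwords with leading terms bounded by its own diwords. Compositions lie in
`Id(S)`, hence in the kernel. In a difference of two monic `S`-diwords with the same leading term,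
that term cancels, which gives the strict bound. When the composition must be resolved by right or
left normed diwords, the same argument runs inside the right or left normed diwords. In the left
normed case the irreducibles are `x_{i₁} ⋯ x_{i_q} ẏ`, independent by `linearIndepOn_leftDiwords`.

It remains that `S` lies in `Id(S₁)`. Relations 4–7 come from multiplying relation 1 by `y`, halving
for 5 and 7. Relation 8 needs `A ≠ 0` (`vdash_eq_dashv`). -/

theorem Submodule.span_sup_mono {R M : Type*} [Semiring R] [AddCommMonoid M] [Module R M]
    {s t : Set M} {P : Submodule R M} (h : s ⊆ t) : span R s ⊔ P ≤ span R t ⊔ P :=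
  sup_le_sup_right (span_mono h) P

/-! ### The deg-lex order on normal diwords. -/

namespace Diword

variable {X : Type*}

theorem lt_iff [LinearOrder X] {u v : Diword X} :
    u < v ↔ u.length < v.length ∨ (u.length = v.length ∧
      (u.left.length < v.left.length ∨ (u.left.length = v.left.length ∧ u.word < v.word))) := by
  change wt u < wt v ↔ _
  simp only [wt, Prod.Lex.toLex_lt_toLex]

theorem length_le_of_le [LinearOrder X] {u v : Diword X} (h : u ≤ v) : u.length ≤ v.length := by
  rcases h.eq_or_lt with rfl | h
  · exact le_rfl
  · rcases lt_iff.1 h with h | h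
    · exact h.le
    · exact h.1.le

theorem length_eq (u : Diword X) : u.length = u.left.length + 1 + u.right.length := by
  simp [length, word]; omega

theorem finite_length_le [Finite X] (n : ℕ) : {u : Diword X | u.length ≤ n}.Finite := by
  refine Set.Finite.of_finite_image (f := fun u : Diword X => (u.left.length, u.word))
    (((Set.finite_le_nat n).prod (List.finite_length_le X n)).subset ?_) ?_
  · rintro _ ⟨u, hu, rfl⟩
    have := u.length_eq
    simp only [Set.mem_ofPred_eq] at hu
    exact ⟨by simp only [Set.mem_ofPred_eq]; omega, hu⟩
  · intro u _ v _ h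
    simp only [Prod.mk.injEq] at h
    exact wt_injective (by simp only [wt, length, h.1, h.2])

/-- Over a finite alphabet only finitely many diwords have bounded length, and the order refines
length, so a minimum may be sought in a finite set. -/
instance [LinearOrder X] [Finite X] : WellFoundedLT (Diword X) := by
  refine ⟨WellFounded.wellFounded_iff_has_min.2 fun s ⟨u, hu⟩ => ?_⟩
  obtain ⟨v, hv, hmin⟩ := Set.exists_min_image (s ∩ {v | v.length ≤ u.length}) id
    ((finite_length_le _).subset Set.inter_subset_right) ⟨u, hu, le_refl u.length⟩
  refine ⟨v, hv.1, fun w hw hwv => ?_⟩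
  exact (hmin w ⟨hw, (length_le_of_le hwv.le).trans hv.2⟩).not_gt hwv

end Diword

/-- With equal lengths the comparison is decided inside `u` and `v`. Without this, `u` could be a
proper prefix of `v` and `b` could reverse the order. -/
theorem List.append_lt_append_of_length_eq {X : Type*} [LinearOrder X] :
    ∀ {u v : List X} (b : List X), u.length = v.length → u < v → u ++ b < v ++ b
  | [], [], _, _, h => absurd h (lt_irrefl _)
  | [], _ :: _, _, h, _ => by simp at h
  | _ :: _, [], _, h, _ => by simp at h
  | x :: u, y :: v, b, h, h' => by
    rw [List.cons_lt_cons_iff] at h'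
    rw [List.cons_append, List.cons_append, List.cons_lt_cons_iff]
    exact h'.imp_right fun h' =>
      ⟨h'.1, List.append_lt_append_of_length_eq b (by simpa using h) h'.2⟩

namespace FreeDialgebra

variable {k X : Type*} [Field k]

theorem wordVdash_add (a : List X) (f g : FreeDialgebra k X) :
    wordVdash a (f + g) = wordVdash a f + wordVdash a g := by
  induction a with
  | nil => rfl
  | cons x a ih =>
    change of k x ⊢ᵈ wordVdash a (f + g) = _
    rw [ih, vdash_add]; rfl

theorem dashvWord_add (b : List X) (f g : FreeDialgebra k X) :
    dashvWord (f + g) b = dashvWord f b + dashvWord g b := by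
  induction b generalizing f g with
  | nil => rfl
  | cons x b ih =>
    change dashvWord ((f + g) ⊣ᵈ of k x) b = _
    rw [add_dashv, ih]; rfl

theorem wordVdash_zero (a : List X) : wordVdash a (0 : FreeDialgebra k X) = 0 := by
  simpa using wordVdash_add a (0 : FreeDialgebra k X) 0

theorem dashvWord_zero (b : List X) : dashvWord (0 : FreeDialgebra k X) b = 0 := by
  simpa using dashvWord_add b (0 : FreeDialgebra k X) 0

theorem of_vdash_single (x : X) (u : Diword X) (t : k) :
    of k x ⊢ᵈ (Finsupp.single u t : FreeDialgebra k X) =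
      Finsupp.single ⟨x :: u.left, u.center, u.right⟩ t := by
  rw [of, single_vdash_single, one_mul]; rfl

theorem single_dashv_of (x : X) (u : Diword X) (t : k) :
    (Finsupp.single u t : FreeDialgebra k X) ⊣ᵈ of k x =
      Finsupp.single ⟨u.left, u.center, u.right ++ [x]⟩ t := by
  rw [of, single_dashv_single, mul_one]; rfl

theorem wordVdash_single (a : List X) (u : Diword X) (t : k) :
    wordVdash a (Finsupp.single u t : FreeDialgebra k X) =
      Finsupp.single ⟨a ++ u.left, u.center, u.right⟩ t := by
  induction a with
  | nil => rfl
  | cons x a ih =>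
    change of k x ⊢ᵈ wordVdash a _ = _
    rw [ih, of_vdash_single]; rfl

theorem dashvWord_single (b : List X) (u : Diword X) (t : k) :
    dashvWord (Finsupp.single u t : FreeDialgebra k X) b =
      Finsupp.single ⟨u.left, u.center, u.right ++ b⟩ t := by
  induction b generalizing u with
  | nil => simp [dashvWord]
  | cons x b ih =>
    change dashvWord (_ ⊣ᵈ of k x) b = _
    rw [single_dashv_of, ih]; simp

theorem exists_isLeadingTerm [LinearOrder X] {f : FreeDialgebra k X} (hf : f ≠ 0) :
    ∃ u, IsLeadingTerm f u :=
  have h := Finsupp.support_nonempty_iff.2 hf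
  ⟨f.support.max' h, f.support.max'_mem h, fun v hv => f.support.le_max' v hv⟩

theorem IsLeadingTerm.eq [LinearOrder X] {f : FreeDialgebra k X} {u v : Diword X}
    (hu : IsLeadingTerm f u) (hv : IsLeadingTerm f v) : u = v :=
  le_antisymm (hv.2 u hu.1) (hu.2 v hv.1)

end FreeDialgebra

namespace DialgebraIdeal

variable {k X : Type*} [Field k]

open FreeDialgebra

theorem wordVdash_mem (I : DialgebraIdeal k (FreeDialgebra k X)) (a : List X)
    {f : FreeDialgebra k X} (hf : f ∈ I.toSubmodule) : wordVdash a f ∈ I.toSubmodule := by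
  induction a with
  | nil => exact hf
  | cons x a ih => exact I.vdash_mem_left _ ih

theorem dashvWord_mem (I : DialgebraIdeal k (FreeDialgebra k X)) (b : List X)
    {f : FreeDialgebra k X} (hf : f ∈ I.toSubmodule) : dashvWord f b ∈ I.toSubmodule := by
  induction b generalizing f with
  | nil => exact hf
  | cons x b ih => exact ih (I.dashv_mem_right _ hf)

theorem eval_mem (I : DialgebraIdeal k (FreeDialgebra k X)) (c : DiContext X)
    {f : FreeDialgebra k X} (hf : f ∈ I.toSubmodule) : c.eval f ∈ I.toSubmodule := by
  cases c with
  | mid a b => exact I.dashvWord_mem b (I.wordVdash_mem a hf)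
  | pre a u => exact I.wordVdash_mem a (I.vdash_mem_right _ hf)
  | post u b => exact I.dashvWord_mem b (I.dashv_mem_left _ hf)

end DialgebraIdeal

/-! ### Leading terms of normal `s`-diwords. -/

namespace DiContext

variable {k X : Type*} [Field k]

open FreeDialgebra

theorem eval_add (c : DiContext X) (f g : FreeDialgebra k X) :
    c.eval (f + g) = c.eval f + c.eval g := by
  cases c <;> simp only [eval, wordVdash_add, dashvWord_add, FreeDialgebra.add_vdash,
    FreeDialgebra.dashv_add]

theorem eval_single (c : DiContext X) (u : Diword X) (t : k) :
    c.eval (Finsupp.single u t) = Finsupp.single (c.plug u) t := by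
  cases c with
  | mid a b => rw [eval, wordVdash_single, dashvWord_single]; rfl
  | pre a u' =>
    rw [eval, single_vdash_single, wordVdash_single, mul_one]
    simp [DialgebraOps.vdash, plug]
  | post u' b =>
    rw [eval, single_dashv_single, dashvWord_single, one_mul]
    simp [DialgebraOps.dashv, plug]

theorem eval_eq_mapDomain (c : DiContext X) (f : FreeDialgebra k X) :
    c.eval f = Finsupp.mapDomain c.plug f := by
  induction f using Finsupp.induction_linear with
  | zero => cases c <;> simp [eval, wordVdash_zero, dashvWord_zero, FreeDialgebra.zero_vdash,
      FreeDialgebra.dashv_zero]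
  | add f g hf hg => rw [eval_add, hf, hg, Finsupp.mapDomain_add]
  | single u t => rw [eval_single, Finsupp.mapDomain_single]

theorem exists_of_mem_support_eval {c : DiContext X} {f : FreeDialgebra k X} {v : Diword X}
    (hv : v ∈ (c.eval f).support) : ∃ u ∈ f.support, c.plug u = v := by
  classical
  rw [eval_eq_mapDomain] at hv
  simpa using Finsupp.mapDomain_support hv

/-- This is where normality matters. If the center lies outside `s`, plugging forgets the position
of the center of the inserted diword, so a comparison decided by that position would be lost. For a
left or right normed `s` the length determines that position, so the case does not arise. -/
theorem plug_lt_plug [LinearOrder X] {c : DiContext X} {f : FreeDialgebra k X} (hc : c.Normal f)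
    {u v : Diword X} (hu : u ∈ f.support) (hv : v ∈ f.support) (h : u < v) :
    c.plug u < c.plug v := by
  have key : ∀ a b : List X, u.length = v.length → u.word < v.word →
      a ++ u.word ++ b < a ++ v.word ++ b := fun a b hl hw => by
    rw [List.append_assoc, List.append_assoc]
    exact List.append_left_lt (List.append_lt_append_of_length_eq b hl hw)
  have hlu : u.word.length = _ := u.length_eq
  have hlv : v.word.length = _ := v.length_eq
  rw [Diword.lt_iff] at h ⊢
  simp only [Diword.length] at h ⊢
  cases c with
  | mid a b =>
    have e : ∀ w : Diword X, ((mid a b).plug w).word = a ++ w.word ++ b := fun w => by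
      simp [plug, Diword.word]
    have e' : ∀ w : Diword X, ((mid a b).plug w).left.length = a.length + w.left.length :=
      fun w => List.length_append
    simp only [e, e', List.length_append] at h ⊢
    rcases h with h | ⟨h1, h | ⟨h2, h⟩⟩
    · left; omega
    · right; exact ⟨by omega, by left; omega⟩
    · right; exact ⟨by omega, Or.inr ⟨by omega, key a b h1 h⟩⟩
  | pre a w =>
    have e : ∀ z : Diword X, ((pre a w).plug z).word =
        a ++ z.word ++ (w.left ++ w.center :: w.right) := fun z => by
      simp [plug, Diword.word]
    have e' : ∀ z : Diword X, ((pre a w).plug z).left.length =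
        a.length + z.word.length + w.left.length := fun z => by
      simp only [plug, List.length_append]
    have hu' : u.right.length = 0 := by rw [hc u hu]; rfl
    have hv' : v.right.length = 0 := by rw [hc v hv]; rfl
    simp only [e, e', List.length_append] at h ⊢
    rcases h with h | ⟨h1, h | ⟨h2, h⟩⟩
    · left; omega
    · omega
    · right; exact ⟨by omega, Or.inr ⟨by omega, key a _ h1 h⟩⟩
  | post w b =>
    have e : ∀ z : Diword X, ((post w b).plug z).word =
        (w.left ++ w.center :: w.right) ++ z.word ++ b := fun z => by
      simp [plug, Diword.word]
    have e' : ∀ z : Diword X, ((post w b).plug z).left.length = w.left.length := fun z => rfl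
    have hu' : u.left.length = 0 := by rw [hc u hu]; rfl
    have hv' : v.left.length = 0 := by rw [hc v hv]; rfl
    simp only [e, e', List.length_append] at h ⊢
    rcases h with h | ⟨h1, h | ⟨h2, h⟩⟩
    · left; omega
    · omega
    · right; exact ⟨by omega, Or.inr ⟨trivial, key _ b h1 h⟩⟩

/-- Since plugging is strictly increasing on the support, no other diword of `f` can collide with
the plugged leading term or exceed it. -/
theorem eval_plug_of_isLeadingTerm [LinearOrder X] {c : DiContext X} {f : FreeDialgebra k X}
    {v : Diword X} (hc : c.Normal f) (hv : IsLeadingTerm f v) :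
    c.eval f (c.plug v) = f v ∧ ∀ t ∈ (c.eval f).support, t ≠ c.plug v → t < c.plug v := by
  classical
  have key : ∀ u ∈ f.support, u ≠ v → c.plug u < c.plug v := fun u hu h =>
    plug_lt_plug hc hu hv.1 ((hv.2 u hu).lt_of_ne h)
  constructor
  · rw [← Finsupp.single_add_erase v f, eval_add, eval_single, Finsupp.add_apply,
      Finsupp.single_eq_same, Finsupp.add_apply, Finsupp.single_eq_same, Finsupp.erase_same]
    congr 1
    by_contra h
    obtain ⟨u, hu, h⟩ := exists_of_mem_support_eval (Finsupp.mem_support_iff.2 h)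
    rw [Finsupp.support_erase, Finset.mem_erase] at hu
    exact (key u hu.2 hu.1).ne h
  · intro t ht h
    obtain ⟨u, hu, rfl⟩ := exists_of_mem_support_eval ht
    exact key u hu fun e => h (by rw [e])

end DiContext

/-! ### Reduction modulo rewriting rules. -/

namespace FreeDialgebra

variable {k X : Type*} [Field k] [LinearOrder X]

/-- Reduction modulo a family of rules: if each diword `t` of `N` outside `B` is the leading term
of a rule in `K t` supported in `N`, then it is a linear combination of rules with leading terms
`≤ t` and of diwords of `B`. -/
theorem single_mem_span_sup_supported [WellFoundedLT (Diword X)] {N B : Set (Diword X)}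
    {K : Diword X → Set (FreeDialgebra k X)}
    (hK : ∀ t ∈ N, t ∉ B → ∃ g ∈ K t, g t = 1 ∧ ∀ v ∈ g.support, v ∈ N ∧ (v ≠ t → v < t))
    (t : Diword X) (ht : t ∈ N) :
    (Finsupp.single t 1 : FreeDialgebra k X) ∈
      Submodule.span k {g | ∃ t' ≤ t, g ∈ K t'} ⊔ Finsupp.supported k k B := by
  classical
  induction t using WellFoundedLT.induction with
  | ind t ih =>
    by_cases hB : t ∈ B
    · exact Submodule.mem_sup_right (Finsupp.single_mem_supported k 1 hB)
    obtain ⟨g, hg, h1, hs⟩ := hK t ht hB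
    -- The rule has coefficient `1` at `t`, so it trades `t` for strictly smaller diwords of `N`, to
    -- which induction applies.
    have e : (Finsupp.single t 1 : FreeDialgebra k X) = g - g.erase t := by
      rw [eq_sub_iff_add_eq, ← h1, Finsupp.single_add_erase]
    rw [e]
    refine Submodule.sub_mem _ (Submodule.mem_sup_left (Submodule.subset_span ⟨t, le_rfl, hg⟩)) ?_
    rw [← Finsupp.sum_single (g.erase t)]
    refine Submodule.sum_mem _ fun v hv => ?_
    rw [Finsupp.support_erase, Finset.mem_erase] at hv
    obtain ⟨hvN, hvt⟩ := hs v hv.2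
    have := Submodule.smul_mem _ (g.erase t v) (ih v (hvt hv.1) hvN)
    rw [Finsupp.smul_single, smul_eq_mul, mul_one] at this
    refine Submodule.span_sup_mono ?_ this
    rintro g ⟨t', ht', hg⟩
    exact ⟨t', ht'.trans (hvt hv.1).le, hg⟩

/-- An element killed by a linear map that kills all rules and is injective on combinations of
irreducible diwords is a combination of rules, with leading terms bounded by its own diwords. -/
theorem mem_span_of_map_eq_zero [WellFoundedLT (Diword X)] {N B : Set (Diword X)}
    {K : Diword X → Set (FreeDialgebra k X)}
    (hK : ∀ t ∈ N, t ∉ B → ∃ g ∈ K t, g t = 1 ∧ ∀ v ∈ g.support, v ∈ N ∧ (v ≠ t → v < t))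
    {M : Type*} [AddCommGroup M] [Module k M] (F : FreeDialgebra k X →ₗ[k] M)
    (hF : ∀ t, ∀ g ∈ K t, F g = 0)
    (hB : LinearIndepOn k (fun u => F (Finsupp.single u 1)) B)
    {h : FreeDialgebra k X} (hN : ∀ t ∈ h.support, t ∈ N) (h0 : F h = 0) :
    h ∈ Submodule.span k {g | ∃ t, g ∈ K t ∧ ∃ v ∈ h.support, t ≤ v} := by
  have key : h ∈ Submodule.span k {g | ∃ t, g ∈ K t ∧ ∃ v ∈ h.support, t ≤ v} ⊔
      Finsupp.supported k k B := by
    rw [← Finsupp.sum_single h]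
    refine Submodule.sum_mem _ fun t ht => ?_
    have := Submodule.smul_mem _ (h t) (single_mem_span_sup_supported hK t (hN t ht))
    rw [Finsupp.smul_single, smul_eq_mul, mul_one] at this
    refine Submodule.span_sup_mono ?_ this
    rintro g ⟨t', ht', hg⟩
    rw [Finsupp.sum_single]
    exact ⟨t', hg, t, ht, ht'⟩
  obtain ⟨p, hp, q, hq, rfl⟩ := Submodule.mem_sup.1 key
  have hFp : F p = 0 := by
    have : Submodule.span k {g | ∃ t, g ∈ K t ∧ ∃ v ∈ (p + q).support, t ≤ v} ≤
        LinearMap.ker F :=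
      Submodule.span_le.2 fun g ⟨t, hg, _⟩ => hF t g hg
    exact this hp
  -- The irreducible remainder `q` has the same image under `F` as `h`, namely zero, and `F` is
  -- injective on combinations of `B`.
  have hq0 : q = 0 := by
    refine linearIndepOn_iff.1 hB q hq ?_
    rw [map_add, hFp, zero_add] at h0
    rw [← h0]
    conv_rhs => rw [← Finsupp.sum_single q]
    rw [map_finsuppSum, Finsupp.linearCombination_apply]
    refine Finsupp.sum_congr fun u _ => ?_
    rw [← map_smul, Finsupp.smul_single, smul_eq_mul, mul_one]
  subst hq0
  simpa using hp

end FreeDialgebra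

/-! ### The Clifford algebra of `A` and its increasing products. -/

namespace CliffordModel

variable {k : Type*} [Field k] {n : ℕ}

open CliffordAlgebra

/-- The bilinear form with lower triangular matrix and the quadratic form of `A`. -/
noncomputable def bilin (A : Matrix (Fin n) (Fin n) k) : LinearMap.BilinForm k (Fin n → k) :=
  Matrix.toLinearMap₂' k
    (Matrix.of fun i j => if i = j then A i i else if j < i then 2 * A i j else 0)

/-- The quadratic form of `A`. -/
noncomputable def quad (A : Matrix (Fin n) (Fin n) k) : QuadraticForm k (Fin n → k) :=
  LinearMap.BilinMap.toQuadraticMap (bilin A)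

/-- The Clifford algebra of `A`. -/
abbrev Cl (A : Matrix (Fin n) (Fin n) k) := CliffordAlgebra (quad A)

/-- The generators of the Clifford algebra. -/
noncomputable def gen (A : Matrix (Fin n) (Fin n) k) (i : Fin n) : Cl A :=
  ι (quad A) (Pi.single i 1)

theorem bilin_single (A : Matrix (Fin n) (Fin n) k) (i j : Fin n) :
    bilin A (Pi.single i 1) (Pi.single j 1) =
      if i = j then A i i else if j < i then 2 * A i j else 0 := by
  rw [bilin, Matrix.toLinearMap₂'_apply', single_one_dotProduct, Matrix.mulVec_single_one]
  rfl

/-- For `i ≠ j` only one of the entries at `(i, j)` and `(j, i)` of the triangular form is nonzero,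
and it already carries the factor `2`. On the diagonal `A i i` is counted twice. -/
theorem polar_single {A : Matrix (Fin n) (Fin n) k} (hA : A.IsSymm) (i j : Fin n) :
    QuadraticMap.polar (quad A) (Pi.single i 1) (Pi.single j 1) = 2 * A i j := by
  rw [quad, LinearMap.BilinMap.polar_toQuadraticMap, bilin_single, bilin_single]
  rcases lt_trichotomy i j with h | rfl | h
  · simp [h, h.ne, h.ne', h.not_gt, hA.apply j i]
  · simp [two_mul]
  · simp [h, h.ne, h.ne', h.not_gt]

/-- Products of generators in increasing order become basis vectors of the exterior algebra. -/
theorem exists_basis_apply_eq (A : Matrix (Fin n) (Fin n) k) :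
    ∃ T : Cl A →ₗ[k] ExteriorAlgebra k (Fin n → k), ∀ l : List (Fin n), l.Pairwise (· < ·) →
      T (l.map (gen A)).prod = (Pi.basisFun k (Fin n)).ExteriorAlgebra l.toFinset := by
  have h : (-bilin A).toQuadraticMap = 0 - quad A := by
    rw [zero_sub, quad, LinearMap.BilinMap.toQuadraticMap_neg]
  refine ⟨changeForm h, fun l hl => ?_⟩
  -- Contraction is an antiderivation, so a functional vanishing on every factor kills the product.
  have contract : ∀ (d : Module.Dual k (Fin n → k)) (l : List (Fin n)),
      (∀ j ∈ l, d (Pi.single j 1) = 0) →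
      contractLeft (Q := (0 : QuadraticForm k (Fin n → k))) d
        (l.map fun i => ι (0 : QuadraticForm k (Fin n → k)) (Pi.single i 1)).prod = 0 := by
    intro d l
    induction l with
    | nil => intro _; simp
    | cons i l ih =>
      intro hd
      rw [List.map_cons, List.prod_cons, contractLeft_ι_mul, ih fun j hj => hd j (by simp [hj]),
        hd i (by simp)]
      simp
  -- Prepending `i` to a word in letters `j > i` produces a correction term contracted against
  -- `bilin A` at `(i, j)`. That entry is zero because the form is lower triangular, so `changeForm`
  -- carries increasing products to increasing products.
  have key : changeForm h (l.map (gen A)).prod =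
      (l.map fun i => ι (0 : QuadraticForm k (Fin n → k)) (Pi.single i 1)).prod := by
    induction l with
    | nil => simp
    | cons i l ih =>
      rw [List.pairwise_cons] at hl
      rw [List.map_cons, List.prod_cons, gen, changeForm_ι_mul, ih hl.2, contract, sub_zero,
        List.map_cons, List.prod_cons]
      intro j hj
      have := hl.1 j hj
      simp [bilin_single, this.ne, this.not_gt]
  -- The exterior basis is indexed by finite sets enumerated increasingly; the increasing list `l`
  -- is that enumeration of its own set.
  have hcard : l.toFinset.card = l.length := List.toFinset_card_of_nodup (hl.imp fun h => h.ne)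
  have hemb : l.get = l.toFinset.orderEmbOfFin hcard :=
    Finset.orderEmbOfFin_unique hcard (by simp) hl.sortedLT.strictMono_get
  rw [key, ExteriorAlgebra.basis_apply_ofCard _ hcard]
  change _ = (List.ofFn fun i => _).prod
  congr 1
  simp only [Set.powersetCard.ofFinEmbEquiv_symm_apply, Function.comp_apply, Pi.basisFun_apply]
  change _ = List.ofFn fun i => ExteriorAlgebra.ι k (Pi.single (l.toFinset.orderEmbOfFin hcard i) 1)
  rw [← hemb]
  exact (List.ofFn_getElem_eq_map l _).symm

theorem linearIndependent_prod_gen (A : Matrix (Fin n) (Fin n) k) :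
    LinearIndependent k fun l : {l : List (Fin n) // l.Pairwise (· < ·)} =>
      (l.1.map (gen A)).prod := by
  obtain ⟨T, hT⟩ := exists_basis_apply_eq A
  refine LinearIndependent.of_comp T ?_
  have : (T ∘ fun l : {l : List (Fin n) // l.Pairwise (· < ·)} => (l.1.map (gen A)).prod) =
      (Pi.basisFun k (Fin n)).ExteriorAlgebra ∘ fun l => l.1.toFinset := by
    ext1 l
    exact hT l.1 l.2
  rw [this]
  refine (Module.Basis.linearIndependent _).comp _ fun l l' h => Subtype.ext ?_
  exact List.Perm.eq_of_pairwise (le := (· < ·)) (fun a b _ _ h h' => absurd h h'.not_gt) l.2 l'.2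
    ((List.perm_ext_iff_of_nodup (l.2.imp fun h => h.ne) (l'.2.imp fun h => h.ne)).2
      fun a => by simpa using congrArg (a ∈ ·) h)

end CliffordModel

/-- The bimodule `V ⊗ Cl` over the Clifford algebra `Cl`, with `V` spanned by `x₁, …, xₙ, e`; it
carries the structure of a dialgebra. -/
abbrev CliffordModel {k : Type*} [Field k] {n : ℕ} (A : Matrix (Fin n) (Fin n) k) :=
  (Fin n → CliffordModel.Cl A) × CliffordModel.Cl A

/-! ### The dialgebra structure on the bimodule `V ⊗ Cl`. -/

namespace CliffordModel

variable {k : Type*} [Field k] {n : ℕ} (A : Matrix (Fin n) (Fin n) k)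

open CliffordAlgebra

theorem ext {a b : CliffordModel A} (h1 : ∀ j, a.1 j = b.1 j) (h2 : a.2 = b.2) : a = b :=
  Prod.ext (funext h1) h2

theorem add_fst (a b : CliffordModel A) (j : Fin n) : (a + b).1 j = a.1 j + b.1 j := rfl

theorem add_snd (a b : CliffordModel A) : (a + b).2 = a.2 + b.2 := rfl

theorem smul_fst (t : k) (a : CliffordModel A) (j : Fin n) : (t • a).1 j = t • a.1 j := rfl

theorem smul_snd (t : k) (a : CliffordModel A) : (t • a).2 = t • a.2 := rfl

/-- The left action of vectors. -/
noncomputable def actVec : (Fin n → k) →ₗ[k] Module.End k (CliffordModel A) :=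
  LinearMap.mk₂ k
    -- The formula is forced by the relations: `v ⊢ x_j = polar(v, x_j) e - x_j ⊣ v` from relation 1
    -- and `v ⊢ e = e ⊣ v` from relation 8, extended to be right `Cl`-linear.
    (fun v m => ((fun j => -(ι (quad A) v * m.1 j),
        ι (quad A) v * m.2 + ∑ j, QuadraticMap.polar (quad A) v (Pi.single j 1) • m.1 j) :
      CliffordModel A))
    (fun v w m => by
      refine ext A (fun j => ?_) ?_
      · simp only [add_fst, map_add, add_mul, neg_add]
      · simp only [add_snd, map_add, add_mul, QuadraticMap.polar_add_left, add_smul,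
          Finset.sum_add_distrib]
        abel)
    (fun t v m => by
      refine ext A (fun j => ?_) ?_
      · simp only [smul_fst, map_smul, smul_mul_assoc, smul_neg]
      · simp only [smul_snd, map_smul, smul_mul_assoc, QuadraticMap.polar_smul_left, smul_add,
          Finset.smul_sum, smul_assoc])
    (fun v m m' => by
      refine ext A (fun j => ?_) ?_
      · simp only [add_fst, mul_add, neg_add]
      · simp only [add_snd, add_fst, mul_add, smul_add, Finset.sum_add_distrib]
        abel)
    (fun t v m => by
      refine ext A (fun j => ?_) ?_
      · simp only [smul_fst, mul_smul_comm, smul_neg]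
      · simp only [smul_snd, smul_fst, mul_smul_comm, smul_add, Finset.smul_sum]
        simp only [smul_comm t])

theorem actVec_fst (v : Fin n → k) (m : CliffordModel A) (j : Fin n) :
    (actVec A v m).1 j = -(ι (quad A) v * m.1 j) := rfl

theorem actVec_snd (v : Fin n → k) (m : CliffordModel A) :
    (actVec A v m).2 = ι (quad A) v * m.2 +
      ∑ j, QuadraticMap.polar (quad A) v (Pi.single j 1) • m.1 j := rfl

/-- The minus sign on the `x_j`-components makes the polar terms of the two applications cancel.
This is the condition for extending the action from vectors to the Clifford algebra. -/
theorem actVec_mul_self (v : Fin n → k) :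
    actVec A v * actVec A v = algebraMap k _ (quad A v) := by
  refine LinearMap.ext fun m => ?_
  rw [Module.End.mul_apply, Module.algebraMap_end_apply]
  refine ext A (fun j => ?_) ?_
  · rw [actVec_fst, actVec_fst, smul_fst, mul_neg, neg_neg, ← mul_assoc, ι_sq_scalar,
      Algebra.smul_def]
  · rw [actVec_snd, actVec_snd, smul_snd, mul_add, ← mul_assoc, ι_sq_scalar, ← Algebra.smul_def]
    simp only [actVec_fst, Finset.mul_sum, smul_neg, mul_smul_comm, Finset.sum_neg_distrib]
    abel

/-- The left action of the Clifford algebra. -/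
noncomputable def act : Cl A →ₐ[k] Module.End k (CliffordModel A) :=
  lift (quad A) ⟨actVec A, actVec_mul_self A⟩

theorem act_ι (v : Fin n → k) : act A (ι (quad A) v) = actVec A v :=
  lift_ι_apply _ _ _

/-- The right action of the Clifford algebra. -/
noncomputable def ract : CliffordModel A →ₗ[k] Cl A →ₗ[k] CliffordModel A :=
  LinearMap.mk₂ k (fun m w => ((fun j => m.1 j * w, m.2 * w) : CliffordModel A))
    (fun m m' w => by refine ext A (fun j => ?_) ?_ <;> simp only [add_fst, add_snd, add_mul])
    (fun t m w => by refine ext A (fun j => ?_) ?_ <;> simp only [smul_fst, smul_snd, smul_mul_assoc])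
    (fun m w w' => by refine ext A (fun j => ?_) ?_ <;> simp only [add_fst, add_snd, mul_add])
    (fun t m w => by refine ext A (fun j => ?_) ?_ <;> simp only [smul_fst, smul_snd, mul_smul_comm])

theorem ract_fst (m : CliffordModel A) (w : Cl A) (j : Fin n) : (ract A m w).1 j = m.1 j * w := rfl

theorem ract_snd (m : CliffordModel A) (w : Cl A) : (ract A m w).2 = m.2 * w := rfl

/-- The bimodule map onto the Clifford algebra. -/
noncomputable def proj : CliffordModel A →ₗ[k] Cl A where
  toFun m := ∑ j, gen A j * m.1 j + m.2
  map_add' a b := by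
    simp only [add_fst, add_snd, mul_add, Finset.sum_add_distrib]
    abel
  map_smul' t a := by
    simp only [smul_fst, smul_snd, mul_smul_comm, smul_add, Finset.smul_sum, RingHom.id_apply]

theorem proj_apply (m : CliffordModel A) : proj A m = ∑ j, gen A j * m.1 j + m.2 := rfl

theorem ract_ract (m : CliffordModel A) (v w : Cl A) :
    ract A (ract A m v) w = ract A m (v * w) := by
  refine ext A (fun j => ?_) ?_ <;> simp only [ract_fst, ract_snd, mul_assoc]

theorem act_ract (v : Cl A) (m : CliffordModel A) (w : Cl A) :
    act A v (ract A m w) = ract A (act A v m) w := by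
  induction v using CliffordAlgebra.left_induction with
  | algebraMap r => simp only [AlgHom.commutes, Module.algebraMap_end_apply, map_smul,
      LinearMap.smul_apply]
  | add x y hx hy => simp only [map_add, LinearMap.add_apply, hx, hy]
  | ι_mul x v hx =>
    rw [map_mul, Module.End.mul_apply, Module.End.mul_apply, hx, act_ι]
    refine ext A (fun j => ?_) ?_
    · simp only [actVec_fst, ract_fst, neg_mul, mul_assoc]
    · simp only [actVec_snd, ract_snd, ract_fst, add_mul, Finset.sum_mul, mul_assoc,
        smul_mul_assoc]

theorem proj_ract (m : CliffordModel A) (w : Cl A) : proj A (ract A m w) = proj A m * w := by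
  simp only [proj_apply, ract_fst, ract_snd, add_mul, Finset.sum_mul, mul_assoc]

/-- For a vector `v` this is the Clifford relation `v x_j + x_j v = polar(v, x_j)`: the polar term
added in the `e`-component compensates for moving `v` past `x_j`. -/
theorem proj_act (w : Cl A) (m : CliffordModel A) : proj A (act A w m) = w * proj A m := by
  induction w using CliffordAlgebra.left_induction with
  | algebraMap r => rw [AlgHom.commutes, Module.algebraMap_end_apply, map_smul, Algebra.smul_def]
  | add x y hx hy => simp only [map_add, LinearMap.add_apply, hx, hy, add_mul]
  | ι_mul x v hx =>
    rw [map_mul, Module.End.mul_apply, mul_assoc, ← hx, act_ι]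
    generalize act A x m = m
    simp only [proj_apply, actVec_fst, actVec_snd, mul_add, Finset.mul_sum]
    rw [add_left_comm, ← Finset.sum_add_distrib, add_comm]
    congr 1
    refine Finset.sum_congr rfl fun j _ => ?_
    rw [Algebra.smul_def, ← ι_mul_ι_add_swap, gen, add_mul, mul_neg, mul_assoc, mul_assoc]
    abel

/-- Any bimodule over an associative algebra, with a bimodule map to that algebra, becomes a
dialgebra in this way. The two bar identities hold because the factor away from the center enters
only through its image in the algebra. -/
noncomputable instance : DialgebraOps (CliffordModel A) where
  vdash a b := act A (proj A a) b
  dashv a b := ract A a (proj A b)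

theorem vdash_def (a b : CliffordModel A) : a ⊢ᵈ b = act A (proj A a) b := rfl

theorem dashv_def (a b : CliffordModel A) : a ⊣ᵈ b = ract A a (proj A b) := rfl

instance : IsDialgebra k (CliffordModel A) where
  add_vdash a b c := by simp [vdash_def]
  vdash_add a b c := by simp [vdash_def]
  smul_vdash t a b := by simp [vdash_def]
  vdash_smul t a b := by simp [vdash_def]
  add_dashv a b c := by simp [dashv_def]
  dashv_add a b c := by simp [dashv_def]
  smul_dashv t a b := by simp [dashv_def]
  dashv_smul t a b := by simp [dashv_def]
  vdash_assoc a b c := by simp [vdash_def, proj_act]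
  dashv_assoc a b c := by simp [dashv_def, proj_ract, ract_ract]
  dashv_vdash a b c := by simp [vdash_def, dashv_def, proj_ract, proj_act]
  dashv_vdash' a b c := by simp [vdash_def, dashv_def, proj_ract]
  vdash_dashv a b c := by simp [vdash_def, dashv_def, act_ract]

/-- The generators of the model. -/
noncomputable def letter : WithTop (Fin n) → CliffordModel A
  | ⊤ => ((fun _ => 0, 1) : (Fin n → Cl A) × Cl A)
  | (i : Fin n) => ((fun j => if j = i then 1 else 0, 0) : (Fin n → Cl A) × Cl A)

/-- The image of a letter in the Clifford algebra. -/
noncomputable def genTop : WithTop (Fin n) → Cl A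
  | ⊤ => 1
  | (i : Fin n) => gen A i

theorem proj_letter (y : WithTop (Fin n)) : proj A (letter A y) = genTop A y := by
  cases y with
  | top => simp [proj_apply, letter, genTop]
  | coe i => simp [proj_apply, letter, genTop]

/-- The coordinates of an element of the model. -/
def coord (m : CliffordModel A) : WithTop (Fin n) → Cl A
  | ⊤ => m.2
  | (i : Fin n) => m.1 i

theorem letter_vdash_letter {A : Matrix (Fin n) (Fin n) k} (hA : A.IsSymm) (i j : Fin n) :
    letter A i ⊢ᵈ letter A j + letter A j ⊣ᵈ letter A i - (2 * A i j) • letter A ⊤ = 0 := by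
  rw [vdash_def, dashv_def, proj_letter, sub_eq_zero]
  change act A (ι _ _) _ + ract A _ (ι _ _) = _
  rw [act_ι]
  refine ext A (fun l => ?_) ?_
  · simp only [add_fst, actVec_fst, ract_fst, smul_fst, letter]
    by_cases h : l = j <;> simp [h]
  · simp only [add_snd, actVec_snd, ract_snd, smul_snd, letter]
    simp [polar_single hA]

theorem top_vdash (m : CliffordModel A) : letter A ⊤ ⊢ᵈ m = m := by
  rw [vdash_def, proj_letter]
  exact LinearMap.congr_fun (map_one (act A)) m

theorem dashv_top (m : CliffordModel A) : m ⊣ᵈ letter A ⊤ = m := by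
  rw [dashv_def, proj_letter]
  refine ext A (fun j => ?_) ?_ <;> simp [ract_fst, ract_snd, genTop]

end CliffordModel

/-! ### The homomorphism to the model and independence of the irreducible diwords. -/

namespace CliffordModel

variable {k : Type*} [Field k] {n : ℕ} (A : Matrix (Fin n) (Fin n) k)

open FreeDialgebra CliffordAlgebra

/-- The homomorphism from the free dialgebra to the model. -/
noncomputable def hom : FreeDialgebra k (WithTop (Fin n)) →ₗ[k] CliffordModel A :=
  (existsUnique_lift (letter A)).choose

theorem hom_vdash (f g : FreeDialgebra k (WithTop (Fin n))) :
    hom A (f ⊢ᵈ g) = hom A f ⊢ᵈ hom A g :=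
  (existsUnique_lift (letter A)).choose_spec.1.1 f g

theorem hom_dashv (f g : FreeDialgebra k (WithTop (Fin n))) :
    hom A (f ⊣ᵈ g) = hom A f ⊣ᵈ hom A g :=
  (existsUnique_lift (letter A)).choose_spec.1.2.1 f g

theorem hom_of (y : WithTop (Fin n)) : hom A (of k y) = letter A y :=
  (existsUnique_lift (letter A)).choose_spec.1.2.2 y

/-- The kernel of `hom`. -/
noncomputable def kerIdeal : DialgebraIdeal k (FreeDialgebra k (WithTop (Fin n))) where
  toSubmodule := LinearMap.ker (hom A)
  vdash_mem_left a f hf := by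
    change hom A _ = 0
    rw [hom_vdash, show hom A f = 0 from hf, vdash_def, map_zero]
  vdash_mem_right {f} a hf := by
    change hom A _ = 0
    rw [hom_vdash, show hom A f = 0 from hf, vdash_def, map_zero, map_zero, LinearMap.zero_apply]
  dashv_mem_left a f hf := by
    change hom A _ = 0
    rw [hom_dashv, show hom A f = 0 from hf, dashv_def, map_zero, map_zero]
  dashv_mem_right {f} a hf := by
    change hom A _ = 0
    rw [hom_dashv, show hom A f = 0 from hf, dashv_def, map_zero, LinearMap.zero_apply]

theorem hom_dashvWord (f : FreeDialgebra k (WithTop (Fin n))) (b : List (WithTop (Fin n))) :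
    hom A (dashvWord f b) = ract A (hom A f) (b.map (genTop A)).prod := by
  induction b generalizing f with
  | nil =>
    change hom A f = _
    refine ext A (fun j => ?_) ?_ <;> simp [ract_fst, ract_snd]
  | cons x b ih =>
    change hom A (dashvWord (f ⊣ᵈ of k x) b) = _
    rw [ih, hom_dashv, hom_of, dashv_def, ract_ract, proj_letter, List.map_cons, List.prod_cons]

theorem hom_wordVdash (f : FreeDialgebra k (WithTop (Fin n))) (a : List (WithTop (Fin n))) :
    hom A (wordVdash a f) = act A (a.map (genTop A)).prod (hom A f) := by
  induction a with
  | nil => simp [wordVdash]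
  | cons x a ih =>
    change hom A (of k x ⊢ᵈ wordVdash a f) = _
    rw [hom_vdash, ih, hom_of, vdash_def, proj_letter, List.map_cons, List.prod_cons, map_mul,
      Module.End.mul_apply]

/-- The linear map of coordinates. -/
def coordMap : CliffordModel A →ₗ[k] (WithTop (Fin n) → Cl A) where
  toFun := coord A
  map_add' a b := by ext y; cases y <;> rfl
  map_smul' t a := by ext y; cases y <;> rfl

/-- The model is a free right `Cl`-module on the letters, so independence of the elements `y ⊗ w`
can be tested one coordinate at a time. -/
theorem coordMap_ract_letter (y : WithTop (Fin n)) (w : Cl A) :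
    coordMap A (ract A (letter A y) w) = Pi.single y w := by
  ext z
  change coord A _ z = _
  cases y <;> cases z <;> simp [coord, ract_fst, ract_snd, letter, Pi.single_apply]

/-- The sign in `actVec` becomes the grade involution, whose injectivity is what `ker_leftMap` uses.
-/
theorem act_fst (w : Cl A) (m : CliffordModel A) (j : Fin n) :
    (act A w m).1 j = involute w * m.1 j := by
  induction w using CliffordAlgebra.left_induction with
  | algebraMap r => rw [AlgHom.commutes, Module.algebraMap_end_apply, AlgHom.commutes, smul_fst,
      Algebra.smul_def]
  | add x y hx hy => simp only [map_add, LinearMap.add_apply, add_fst, hx, hy, add_mul]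
  | ι_mul x v hx =>
    rw [map_mul, map_mul, Module.End.mul_apply, act_ι, actVec_fst, hx, involute_ι, neg_mul,
      neg_mul, mul_assoc]

theorem act_letter_top (w : Cl A) : act A w (letter A ⊤) = ract A (letter A ⊤) w := by
  induction w using CliffordAlgebra.left_induction with
  | algebraMap r =>
    rw [AlgHom.commutes, Module.algebraMap_end_apply]
    refine ext A (fun j => ?_) ?_
    · simp [ract_fst, letter]
    · rw [ract_snd, smul_snd, Algebra.smul_def]
      exact (Algebra.commutes _ _)
  | add x y hx hy => simp only [map_add, LinearMap.add_apply, hx, hy]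
  | ι_mul x v hx =>
    rw [map_mul, Module.End.mul_apply, hx, act_ι]
    refine ext A (fun j => ?_) ?_
    · simp [ract_fst, actVec_fst, letter]
    · simp [ract_snd, actVec_snd, ract_fst, letter]

/-- The map sending `y ⊗ w` to `w ⊢ y`. -/
noncomputable def leftMap : (WithTop (Fin n) → Cl A) →ₗ[k] CliffordModel A :=
  ∑ y, (LinearMap.applyₗ (letter A y)) ∘ₗ (act A).toLinearMap ∘ₗ LinearMap.proj y

theorem leftMap_apply (f : WithTop (Fin n) → Cl A) :
    leftMap A f = ∑ y, act A (f y) (letter A y) := by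
  simp [leftMap]

theorem leftMap_single (y : WithTop (Fin n)) (w : Cl A) :
    leftMap A (Pi.single y w) = act A w (letter A y) := by
  rw [leftMap_apply, Finset.sum_eq_single y]
  · rw [Pi.single_eq_same]
  · intro z _ hz
    rw [Pi.single_eq_of_ne hz, map_zero, LinearMap.zero_apply]
  · simp

/-- The map is triangular. The `x_j`-coordinate of `∑ f(y) ⊢ y` is the involute of `f(x_j)`, since
no other letter contributes to it. Once these vanish, only `f(e) ⊢ e = e ⊣ f(e)` is left. -/
theorem ker_leftMap : LinearMap.ker (leftMap A) = ⊥ := by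
  rw [LinearMap.ker_eq_bot']
  intro f hf
  rw [leftMap_apply] at hf
  have hsum : ∀ j, ∑ y, (act A (f y) (letter A y)).1 j = 0 := fun j => by
    rw [← Finset.sum_apply, ← Prod.fst_sum, hf]; rfl
  have h1 : ∀ j : Fin n, f j = 0 := fun j => by
    have h := hsum j
    rw [Finset.sum_eq_single (j : WithTop (Fin n))] at h
    · rw [act_fst] at h
      exact involute_involutive.injective (by simpa [letter] using h)
    · intro y _ hy
      rw [act_fst]
      cases y with
      | top => simp [letter]
      | coe i =>
        have : j ≠ i := fun h => hy (by rw [h])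
        simp [letter, this]
    · simp
  rw [Finset.sum_eq_single (⊤ : WithTop (Fin n)), act_letter_top] at hf
  · ext1 y
    cases y with
    | top => simpa [ract_snd, letter] using congrArg Prod.snd hf
    | coe i => exact h1 i
  · intro y _ hy
    cases y with
    | top => exact absurd rfl hy
    | coe i => rw [h1, map_zero, LinearMap.zero_apply]
  · simp

theorem map_genTop_coe (l : List (Fin n)) :
    (l.map WithTop.some).map (genTop A) = l.map (gen A) := by
  rw [List.map_map]; rfl

theorem linearIndependent_single_prod_gen :
    LinearIndependent k fun p : (_ : WithTop (Fin n)) × {l : List (Fin n) // l.Pairwise (· < ·)} =>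
      (Pi.single p.1 (p.2.1.map (gen A)).prod : WithTop (Fin n) → Cl A) :=
  Pi.linearIndependent_single (fun _ => fun l : {l : List (Fin n) // l.Pairwise (· < ·)} =>
    (l.1.map (gen A)).prod) fun _ => linearIndependent_prod_gen A

theorem mem_basisDiwords_iff {u : Diword (WithTop (Fin n))} :
    u ∈ CliffordDialgebra.basisDiwords n ↔ ∃ (y : WithTop (Fin n)) (l : List (Fin n)),
      l.Pairwise (· < ·) ∧ u = ⟨[], y, l.map WithTop.some⟩ := by
  -- The letters in `basisDiwords` are embedded through a monadic bind over the list, which agrees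
  -- with a plain map.
  have (l : List (Fin n)) : (do let a ← l; pure (a : WithTop (Fin n))) = l.map WithTop.some :=
    List.map_eq_flatMap.symm
  simp only [CliffordDialgebra.basisDiwords, Set.mem_ofPred_eq, this, List.map_id']

theorem linearIndepOn_basisDiwords :
    LinearIndepOn k (fun u => hom A (Finsupp.single u 1)) (CliffordDialgebra.basisDiwords n) := by
  let e : (_ : WithTop (Fin n)) × {l : List (Fin n) // l.Pairwise (· < ·)} →
    Diword (WithTop (Fin n)) := fun p => ⟨[], p.1, p.2.1.map WithTop.some⟩
  have he : CliffordDialgebra.basisDiwords n ⊆ Set.range e := by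
    intro u hu
    obtain ⟨y, l, hl, rfl⟩ := mem_basisDiwords_iff.1 hu
    exact ⟨⟨y, l, hl⟩, rfl⟩
  refine LinearIndepOn.mono ?_ he
  have hinj : Function.Injective e := by
    rintro ⟨y, l, hl⟩ ⟨y', l', hl'⟩ h
    simp only [e, Diword.mk.injEq, true_and] at h
    obtain ⟨rfl, h⟩ := h
    obtain rfl := List.map_injective_iff.2 WithTop.coe_injective h
    rfl
  rw [linearIndepOn_range_iff hinj]
  refine LinearIndependent.of_comp (coordMap A) ?_
  convert linearIndependent_single_prod_gen A with p
  have := dashvWord_single (k := k) (p.2.1.map WithTop.some)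
    (Diword.letter p.1) 1
  simp only [Function.comp_apply, e]
  rw [← map_genTop_coe, ← coordMap_ract_letter, ← hom_of, ← hom_dashvWord, of, this]
  rfl

/-- The normal diwords `x_{i₁} ⋯ x_{i_q} ẏ` with `i₁ < ⋯ < i_q`. -/
def leftDiwords (n : ℕ) : Set (Diword (WithTop (Fin n))) :=
  {u | ∃ (y : WithTop (Fin n)) (l : List (Fin n)), l.Pairwise (· < ·) ∧
    u = ⟨l.map WithTop.some, y, []⟩}

/-- With the center last, the image of a diword is `w ⊢ y`, that is, `leftMap` applied to `w` in
slot `y`; injectivity of `leftMap` transports independence. -/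
theorem linearIndepOn_leftDiwords :
    LinearIndepOn k (fun u => hom A (Finsupp.single u 1)) (leftDiwords n) := by
  let e : (_ : WithTop (Fin n)) × {l : List (Fin n) // l.Pairwise (· < ·)} →
    Diword (WithTop (Fin n)) := fun p => ⟨p.2.1.map WithTop.some, p.1, []⟩
  have he : leftDiwords n ⊆ Set.range e := by
    rintro _ ⟨y, l, hl, rfl⟩
    exact ⟨⟨y, l, hl⟩, rfl⟩
  refine LinearIndepOn.mono ?_ he
  have hinj : Function.Injective e := by
    rintro ⟨y, l, hl⟩ ⟨y', l', hl'⟩ h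
    simp only [e, Diword.mk.injEq, and_true] at h
    obtain ⟨h, rfl⟩ := h
    obtain rfl := List.map_injective_iff.2 WithTop.coe_injective h
    rfl
  rw [linearIndepOn_range_iff hinj]
  have heq : (fun u => hom A (Finsupp.single u 1)) ∘ e = leftMap A ∘
      fun p => Pi.single p.1 (p.2.1.map (gen A)).prod := by
    ext1 p
    have := wordVdash_single (k := k) (p.2.1.map WithTop.some) (Diword.letter p.1) 1
    simp only [Function.comp_apply, e]
    rw [leftMap_single, ← map_genTop_coe, ← hom_of, ← hom_wordVdash, of, this]
    simp [Diword.letter]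
  rw [heq]
  exact (linearIndependent_single_prod_gen A).map' (leftMap A) (ker_leftMap A)

end CliffordModel

/-! ### Relations with at most three terms, and `S`-diwords as rules. -/

namespace FreeDialgebra

variable {k X : Type*} [Field k]

/-- The element `u + p a - q b`. -/
noncomputable def trinomial (u a b : Diword X) (p q : k) : FreeDialgebra k X :=
  Finsupp.single u 1 + Finsupp.single a p - Finsupp.single b q

theorem eq_of_mem_support_trinomial {u a b v : Diword X} {p q : k}
    (h : v ∈ (trinomial u a b p q).support) : v = u ∨ v = a ∨ v = b := by
  classical
  by_contra! hv
  rw [Finsupp.mem_support_iff] at h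
  simp [trinomial, hv.1.symm, hv.2.1.symm, hv.2.2.symm] at h

theorem isLeadingTerm_trinomial [LinearOrder X] {u a b : Diword X} (p q : k) (ha : a < u)
    (hb : b < u) :
    IsLeadingTerm (trinomial u a b p q) u ∧ trinomial u a b p q u = 1 := by
  have h : trinomial u a b p q u = 1 := by simp [trinomial, ha.ne, hb.ne]
  refine ⟨⟨by simp [h], fun v hv => ?_⟩, h⟩
  rcases eq_of_mem_support_trinomial hv with rfl | rfl | rfl
  exacts [le_rfl, ha.le, hb.le]

theorem rightNormed_trinomial {u a b : Diword X} (p q : k) (hu : u.left = []) (ha : a.left = [])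
    (hb : b.left = []) : RightNormed (trinomial u a b p q) := by
  intro v hv
  rcases eq_of_mem_support_trinomial hv with rfl | rfl | rfl <;> assumption

theorem leftNormed_trinomial {u a b : Diword X} (p q : k) (hu : u.right = []) (ha : a.right = [])
    (hb : b.right = []) : LeftNormed (trinomial u a b p q) := by
  intro v hv
  rcases eq_of_mem_support_trinomial hv with rfl | rfl | rfl <;> assumption

variable {S : Set (FreeDialgebra k X)}

/-- The letter just before `m` is either the center or some `z` to its right. Since `S` has a rule
for each possible preceding letter, it can be placed at the center or after it, respectively. -/
theorem exists_rightNormedDiword [LinearOrder X] {m : List X}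
    (hm : ∀ z, ∃ s ∈ S, IsLeadingTerm s ⟨[], z, m⟩ ∧ RightNormed s) (y : X) (r₁ r₂ : List X) :
    ∃ s ∈ S, ∃ (c : DiContext X) (v : Diword X), IsLeadingTerm s v ∧ c.RightNormedDiword s ∧
      c.plug v = ⟨[], y, r₁ ++ m ++ r₂⟩ := by
  rcases r₁.eq_nil_or_concat' with rfl | ⟨r, z, rfl⟩
  · obtain ⟨s, hs, hl, hr⟩ := hm y
    refine ⟨s, hs, .mid [] r₂, _, hl, ⟨trivial, hr, fun v hv => ?_⟩, rfl⟩
    obtain ⟨u, hu, rfl⟩ := DiContext.exists_of_mem_support_eval hv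
    exact hr u hu
  · obtain ⟨s, hs, hl, hr⟩ := hm z
    refine ⟨s, hs, .post ⟨[], y, r⟩ r₂, _, hl, ⟨hr, hr, fun v hv => ?_⟩, ?_⟩
    · obtain ⟨u, hu, rfl⟩ := DiContext.exists_of_mem_support_eval hv
      rfl
    · simp [DiContext.plug, Diword.word]

theorem exists_leftNormedDiword [LinearOrder X] {m : List X}
    (hm : ∀ z, ∃ s ∈ S, IsLeadingTerm s ⟨m, z, []⟩ ∧ LeftNormed s) (y : X) (l₁ l₂ : List X) :
    ∃ s ∈ S, ∃ (c : DiContext X) (v : Diword X), IsLeadingTerm s v ∧ c.LeftNormedDiword s ∧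
      c.plug v = ⟨l₁ ++ m ++ l₂, y, []⟩ := by
  rcases l₂ with _ | ⟨z, l⟩
  · obtain ⟨s, hs, hl, hr⟩ := hm y
    refine ⟨s, hs, .mid l₁ [], _, hl, ⟨trivial, hr, fun v hv => ?_⟩, by simp [DiContext.plug]⟩
    obtain ⟨u, hu, rfl⟩ := DiContext.exists_of_mem_support_eval hv
    simp [DiContext.plug, hr u hu]
  · obtain ⟨s, hs, hl, hr⟩ := hm z
    refine ⟨s, hs, .pre l₁ ⟨l, y, []⟩, _, hl, ⟨hr, hr, fun v hv => ?_⟩, ?_⟩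
    · obtain ⟨u, hu, rfl⟩ := DiContext.exists_of_mem_support_eval hv
      rfl
    · simp [DiContext.plug, Diword.word]

/-- The rules given by the `S`-diwords with property `Q` and leading term `t`. -/
def rules [LinearOrder X] (S : Set (FreeDialgebra k X))
    (Q : DiContext X → FreeDialgebra k X → Prop) (t : Diword X) : Set (FreeDialgebra k X) :=
  {g | ∃ s ∈ S, ∃ (c : DiContext X) (v : Diword X), IsLeadingTerm s v ∧ Q c s ∧ c.plug v = t ∧
    g = c.eval s}

variable [LinearOrder X] {N B : Set (Diword X)} {Q : DiContext X → FreeDialgebra k X → Prop}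

theorem exists_mem_rules (hS : ∀ s ∈ S, Monic s)
    (hQ : ∀ c s, Q c s → c.Normal s ∧ ∀ v ∈ (c.eval s).support, v ∈ N)
    (hrule : ∀ t ∈ N, t ∉ B → ∃ s ∈ S, ∃ (c : DiContext X) (v : Diword X),
      IsLeadingTerm s v ∧ Q c s ∧ c.plug v = t) :
    ∀ t ∈ N, t ∉ B → ∃ g ∈ rules S Q t, g t = 1 ∧ ∀ v ∈ g.support, v ∈ N ∧ (v ≠ t → v < t) := by
  intro t ht hB
  obtain ⟨s, hs, c, v, hv, hc, rfl⟩ := hrule t ht hB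
  obtain ⟨h1, h2⟩ := hQ c s hc
  obtain ⟨h3, h4⟩ := DiContext.eval_plug_of_isLeadingTerm h1 hv
  refine ⟨c.eval s, ⟨s, hs, c, v, hv, hc, rfl, rfl⟩, ?_, fun z hz => ⟨h2 z hz, h4 z hz⟩⟩
  obtain ⟨u, hu, hu1⟩ := hS s hs
  rw [h3, hv.eq hu, hu1]

theorem isCombination_of_map_eq_zero [WellFoundedLT (Diword X)] (hS : ∀ s ∈ S, Monic s)
    (hQ : ∀ c s, Q c s → c.Normal s ∧ ∀ v ∈ (c.eval s).support, v ∈ N)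
    (hrule : ∀ t ∈ N, t ∉ B → ∃ s ∈ S, ∃ (c : DiContext X) (v : Diword X),
      IsLeadingTerm s v ∧ Q c s ∧ c.plug v = t)
    {M : Type*} [AddCommGroup M] [Module k M] (F : FreeDialgebra k X →ₗ[k] M)
    (hF : ∀ s ∈ S, ∀ c : DiContext X, F (c.eval s) = 0)
    (hB : LinearIndepOn k (fun u => F (Finsupp.single u 1)) B)
    {h : FreeDialgebra k X} (hN : ∀ t ∈ h.support, t ∈ N) (h0 : F h = 0)
    {P : DiContext X → FreeDialgebra k X → Diword X → Prop}
    (hP : ∀ c s v, Q c s → (∃ z ∈ h.support, v ≤ z) → P c s v) : IsCombination S P h := by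
  refine Submodule.span_mono ?_
    (mem_span_of_map_eq_zero (exists_mem_rules hS hQ hrule) F ?_ hB hN h0)
  · rintro g ⟨_, ⟨s, hs, c, v, hv, hc, rfl, rfl⟩, hz⟩
    exact ⟨s, hs, c, v, hv, hP c s _ hc hz, rfl⟩
  · rintro _ _ ⟨s, hs, c, v, -, -, -, rfl⟩
    exact hF s hs c

/-- Both terms have coefficient `1` at the common leading diword, so it cancels in the difference.
-/
theorem lt_of_mem_support_eval_sub {f g : FreeDialgebra k X} {c d : DiContext X}
    {u v z : Diword X} (hu : IsLeadingTerm f u) (hv : IsLeadingTerm g v) (hf : Monic f)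
    (hg : Monic g) (hc : c.Normal f) (hd : d.Normal g) (h : c.plug u = d.plug v)
    (hz : z ∈ (c.eval f - d.eval g).support) : z < c.plug u := by
  classical
  obtain ⟨u', hu', h1⟩ := hf
  obtain ⟨v', hv', h2⟩ := hg
  obtain rfl := hu.eq hu'
  obtain rfl := hv.eq hv'
  obtain ⟨h3, h4⟩ := DiContext.eval_plug_of_isLeadingTerm hc hu
  obtain ⟨h5, h6⟩ := DiContext.eval_plug_of_isLeadingTerm hd hv
  have hne : z ≠ c.plug u := by
    rintro rfl
    rw [Finsupp.mem_support_iff, Finsupp.sub_apply, h3, h, h5, h1, h2, sub_self] at hz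
    exact hz rfl
  rcases Finset.mem_union.1 (Finsupp.support_sub hz) with hz | hz
  · exact h4 z hz hne
  · rw [h] at hne ⊢
    exact h6 z hz hne

end FreeDialgebra

theorem List.exists_descent {α : Type*} [LinearOrder α] : ∀ l : List α, ¬ l.Pairwise (· < ·) →
    ∃ r₁ i j r₂, l = r₁ ++ [i, j] ++ r₂ ∧ j ≤ i
  | [], h => absurd List.Pairwise.nil h
  | [_], h => absurd (List.pairwise_singleton _ _) h
  | x :: y :: l, h => by
    by_cases hxy : x < y
    · have : ¬ (y :: l).Pairwise (· < ·) := fun h' => h (by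
        rw [← List.isChain_iff_pairwise] at h' ⊢
        exact List.isChain_cons_cons.2 ⟨hxy, h'⟩)
      obtain ⟨r₁, i, j, r₂, h1, h2⟩ := List.exists_descent _ this
      exact ⟨x :: r₁, i, j, r₂, by rw [h1]; rfl, h2⟩
    · exact ⟨[], x, y, l, rfl, not_lt.1 hxy⟩

/-- The patterns `m` are the words found beside the center in the leading terms of relations 3, 4,
5, and equally of 2, 6, 7. -/
theorem List.exists_top_or_descent {α : Type*} [LinearOrder α] (l : List (WithTop α))
    (h : ¬ ∃ l' : List α, l'.Pairwise (· < ·) ∧ l = l'.map WithTop.some) :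
    ∃ r₁ m r₂, l = r₁ ++ m ++ r₂ ∧
      (m = [⊤] ∨ ∃ i j : α, j ≤ i ∧ m = [(i : WithTop α), (j : WithTop α)]) := by
  by_cases ht : (⊤ : WithTop α) ∈ l
  · obtain ⟨r₁, r₂, rfl⟩ := List.append_of_mem ht
    exact ⟨r₁, [⊤], r₂, by simp, Or.inl rfl⟩
  · lift l to List α using fun x hx h => ht (h ▸ hx)
    obtain ⟨r₁, i, j, r₂, rfl, hij⟩ := List.exists_descent l fun h' => h ⟨l, h', rfl⟩
    exact ⟨r₁.map WithTop.some, [(i : WithTop α), (j : WithTop α)], r₂.map WithTop.some, by simp,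
      Or.inr ⟨i, j, hij, rfl⟩⟩

/-! ### Leading terms of the relations and the irreducible diwords. -/

namespace CliffordDialgebra

open FreeDialgebra

variable {k : Type*} [Field k] {n : ℕ}

section Relations

theorem r1_eq (A : Matrix (Fin n) (Fin n) k) (i j : Fin n) :
    x k i ⊢ᵈ x k j + x k j ⊣ᵈ x k i - (2 * A i j) • e k n =
      trinomial ⟨[↑i], ↑j, []⟩ ⟨[], ↑j, [↑i]⟩ ⟨[], ⊤, []⟩ 1 (2 * A i j) := by
  simp only [x, e, of, single_vdash_single, single_dashv_single, mul_one, Finsupp.smul_single,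
    smul_eq_mul, trinomial]
  rfl

/-- A relation with two terms is a trinomial with `p = 0`. The unused middle diword repeats the last
one, so it too lies below the leading term. -/
theorem r2_eq (y : WithTop (Fin n)) :
    e k n ⊢ᵈ of k y - of k y = trinomial ⟨[⊤], y, []⟩ ⟨[], y, []⟩ ⟨[], y, []⟩ 0 1 := by
  simp only [x, e, of, single_vdash_single, single_dashv_single, mul_one, trinomial,
    Finsupp.single_zero, add_zero]
  rfl

theorem r3_eq (y : WithTop (Fin n)) :
    of k y ⊣ᵈ e k n - of k y = trinomial ⟨[], y, [⊤]⟩ ⟨[], y, []⟩ ⟨[], y, []⟩ 0 1 := by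
  simp only [x, e, of, single_vdash_single, single_dashv_single, mul_one, trinomial,
    Finsupp.single_zero, add_zero]
  rfl

theorem r4_eq (A : Matrix (Fin n) (Fin n) k) (y : WithTop (Fin n)) (i j : Fin n) :
    of k y ⊣ᵈ x k i ⊣ᵈ x k j + of k y ⊣ᵈ x k j ⊣ᵈ x k i - (2 * A i j) • of k y =
      trinomial ⟨[], y, [↑i, ↑j]⟩ ⟨[], y, [↑j, ↑i]⟩ ⟨[], y, []⟩ 1 (2 * A i j) := by
  simp only [x, e, of, single_vdash_single, single_dashv_single, mul_one, Finsupp.smul_single,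
    smul_eq_mul, trinomial]
  rfl

theorem r5_eq (A : Matrix (Fin n) (Fin n) k) (y : WithTop (Fin n)) (i : Fin n) :
    of k y ⊣ᵈ x k i ⊣ᵈ x k i - A i i • of k y =
      trinomial ⟨[], y, [↑i, ↑i]⟩ ⟨[], y, []⟩ ⟨[], y, []⟩ 0 (A i i) := by
  simp only [x, e, of, single_vdash_single, single_dashv_single, mul_one, Finsupp.smul_single,
    smul_eq_mul, trinomial, Finsupp.single_zero, add_zero]
  rfl

theorem r6_eq (A : Matrix (Fin n) (Fin n) k) (y : WithTop (Fin n)) (i j : Fin n) :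
    x k i ⊢ᵈ x k j ⊢ᵈ of k y + x k j ⊢ᵈ x k i ⊢ᵈ of k y - (2 * A i j) • of k y =
      trinomial ⟨[↑i, ↑j], y, []⟩ ⟨[↑j, ↑i], y, []⟩ ⟨[], y, []⟩ 1 (2 * A i j) := by
  simp only [x, e, of, single_vdash_single, single_dashv_single, mul_one, Finsupp.smul_single,
    smul_eq_mul, trinomial]
  rfl

theorem r7_eq (A : Matrix (Fin n) (Fin n) k) (y : WithTop (Fin n)) (i : Fin n) :
    x k i ⊢ᵈ x k i ⊢ᵈ of k y - A i i • of k y =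
      trinomial ⟨[↑i, ↑i], y, []⟩ ⟨[], y, []⟩ ⟨[], y, []⟩ 0 (A i i) := by
  simp only [x, e, of, single_vdash_single, single_dashv_single, mul_one, Finsupp.smul_single,
    smul_eq_mul, trinomial, Finsupp.single_zero, add_zero]
  rfl

theorem r8_eq (i : Fin n) :
    x k i ⊢ᵈ e k n - e k n ⊣ᵈ x k i =
      trinomial ⟨[↑i], ⊤, []⟩ ⟨[], ⊤, [↑i]⟩ ⟨[], ⊤, [↑i]⟩ 0 1 := by
  simp only [x, e, of, single_vdash_single, single_dashv_single, mul_one, trinomial,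
    Finsupp.single_zero, add_zero]
  rfl

end Relations

section Reduction

variable (A : Matrix (Fin n) (Fin n) k)

theorem isLeadingTerm_r1 (i j : Fin n) :
    ∃ s ∈ gsRelations A, IsLeadingTerm s ⟨[(i : WithTop (Fin n))], ↑j, []⟩ := by
  refine ⟨_, .r1 i j, ?_⟩
  rw [r1_eq]
  exact (isLeadingTerm_trinomial _ _ (by simp [Diword.lt_iff, Diword.length, Diword.word])
    (by simp [Diword.lt_iff, Diword.length, Diword.word])).1

theorem isLeadingTerm_r8 (i : Fin n) :
    ∃ s ∈ gsRelations A, IsLeadingTerm s ⟨[(i : WithTop (Fin n))], ⊤, []⟩ := by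
  refine ⟨_, .r8 i, ?_⟩
  rw [r8_eq]
  exact (isLeadingTerm_trinomial _ _ (by simp [Diword.lt_iff, Diword.length, Diword.word])
    (by simp [Diword.lt_iff, Diword.length, Diword.word])).1

theorem isLeadingTerm_right {m : List (WithTop (Fin n))}
    (hm : m = [⊤] ∨ ∃ i j : Fin n, j ≤ i ∧ m = [(i : WithTop (Fin n)), (j : WithTop (Fin n))])
    (y : WithTop (Fin n)) :
    ∃ s ∈ gsRelations A, IsLeadingTerm s ⟨[], y, m⟩ ∧ RightNormed s := by
  rcases hm with rfl | ⟨i, j, hij, rfl⟩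
  · refine ⟨_, .r3 y, ?_⟩
    rw [r3_eq]
    exact ⟨(isLeadingTerm_trinomial _ _ (by simp [Diword.lt_iff, Diword.length, Diword.word])
      (by simp [Diword.lt_iff, Diword.length, Diword.word])).1,
      rightNormed_trinomial _ _ rfl rfl rfl⟩
  · rcases hij.eq_or_lt with rfl | hij
    · refine ⟨_, .r5 y j, ?_⟩
      rw [r5_eq]
      exact ⟨(isLeadingTerm_trinomial _ _ (by simp [Diword.lt_iff, Diword.length, Diword.word])
        (by simp [Diword.lt_iff, Diword.length, Diword.word])).1,
        rightNormed_trinomial _ _ rfl rfl rfl⟩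
    · refine ⟨_, .r4 y i j hij, ?_⟩
      rw [r4_eq]
      exact ⟨(isLeadingTerm_trinomial _ _
        (by simp [Diword.lt_iff, Diword.length, Diword.word, List.cons_lt_cons_iff, hij])
        (by simp [Diword.lt_iff, Diword.length, Diword.word])).1,
        rightNormed_trinomial _ _ rfl rfl rfl⟩

theorem isLeadingTerm_left {m : List (WithTop (Fin n))}
    (hm : m = [⊤] ∨ ∃ i j : Fin n, j ≤ i ∧ m = [(i : WithTop (Fin n)), (j : WithTop (Fin n))])
    (y : WithTop (Fin n)) :
    ∃ s ∈ gsRelations A, IsLeadingTerm s ⟨m, y, []⟩ ∧ LeftNormed s := by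
  rcases hm with rfl | ⟨i, j, hij, rfl⟩
  · refine ⟨_, .r2 y, ?_⟩
    rw [r2_eq]
    exact ⟨(isLeadingTerm_trinomial _ _ (by simp [Diword.lt_iff, Diword.length, Diword.word])
      (by simp [Diword.lt_iff, Diword.length, Diword.word])).1,
      leftNormed_trinomial _ _ rfl rfl rfl⟩
  · rcases hij.eq_or_lt with rfl | hij
    · refine ⟨_, .r7 y j, ?_⟩
      rw [r7_eq]
      exact ⟨(isLeadingTerm_trinomial _ _ (by simp [Diword.lt_iff, Diword.length, Diword.word])
        (by simp [Diword.lt_iff, Diword.length, Diword.word])).1,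
        leftNormed_trinomial _ _ rfl rfl rfl⟩
    · refine ⟨_, .r6 y i j hij, ?_⟩
      rw [r6_eq]
      exact ⟨(isLeadingTerm_trinomial _ _
        (by simp [Diword.lt_iff, Diword.length, Diword.word, List.cons_lt_cons_iff, hij])
        (by simp [Diword.lt_iff, Diword.length, Diword.word])).1,
        leftNormed_trinomial _ _ rfl rfl rfl⟩

theorem exists_leadingTerm_of_mem {f : FreeDialgebra k (WithTop (Fin n))}
    (hf : f ∈ gsRelations A) : ∃ u, IsLeadingTerm f u ∧ f u = 1 ∧ 2 ≤ u.length := by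
  have key : ∃ u a b p q, f = trinomial u a b p q ∧ a < u ∧ b < u ∧ 2 ≤ u.length := by
    cases hf with
    | r1 i j => exact ⟨_, _, _, _, _, r1_eq A i j,
        by simp [Diword.lt_iff, Diword.length, Diword.word]⟩
    | r2 y => exact ⟨_, _, _, _, _, r2_eq y, by simp [Diword.lt_iff, Diword.length, Diword.word]⟩
    | r3 y => exact ⟨_, _, _, _, _, r3_eq y, by simp [Diword.lt_iff, Diword.length, Diword.word]⟩
    | r4 y i j hij => exact ⟨_, _, _, _, _, r4_eq A y i j,
        by simp [Diword.lt_iff, Diword.length, Diword.word, List.cons_lt_cons_iff, hij]⟩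
    | r5 y i => exact ⟨_, _, _, _, _, r5_eq A y i,
        by simp [Diword.lt_iff, Diword.length, Diword.word]⟩
    | r6 y i j hij => exact ⟨_, _, _, _, _, r6_eq A y i j,
        by simp [Diword.lt_iff, Diword.length, Diword.word, List.cons_lt_cons_iff, hij]⟩
    | r7 y i => exact ⟨_, _, _, _, _, r7_eq A y i,
        by simp [Diword.lt_iff, Diword.length, Diword.word]⟩
    | r8 i => exact ⟨_, _, _, _, _, r8_eq i, by simp [Diword.lt_iff, Diword.length, Diword.word]⟩
  obtain ⟨u, a, b, p, q, rfl, ha, hb, hu⟩ := key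
  exact ⟨u, (isLeadingTerm_trinomial p q ha hb).1, (isLeadingTerm_trinomial p q ha hb).2, hu⟩

theorem monic_of_mem {f : FreeDialgebra k (WithTop (Fin n))} (hf : f ∈ gsRelations A) :
    Monic f :=
  let ⟨u, h1, h2, _⟩ := exists_leadingTerm_of_mem A hf
  ⟨u, h1, h2⟩

/-- A diword with its center both first and last is a single letter, whereas leading terms in `S`
have length at least two. Hence the left and right normed clauses of triviality never compete. -/
theorem not_leftNormed_and_rightNormed {f : FreeDialgebra k (WithTop (Fin n))}
    (hf : f ∈ gsRelations A) (hl : LeftNormed f) (hr : RightNormed f) : False := by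
  obtain ⟨u, hu, -, h⟩ := exists_leadingTerm_of_mem A hf
  rw [u.length_eq, hl u hu.1, hr u hu.1] at h
  simp at h

theorem exists_rightNormed_rule {t : Diword (WithTop (Fin n))} (ht : t.left = [])
    (hB : t ∉ basisDiwords n) :
    ∃ s ∈ gsRelations A, ∃ (c : DiContext (WithTop (Fin n))) (v : Diword (WithTop (Fin n))),
      IsLeadingTerm s v ∧ c.RightNormedDiword s ∧ c.plug v = t := by
  obtain ⟨l, y, r⟩ := t
  obtain rfl : l = [] := ht
  obtain ⟨r₁, m, r₂, rfl, hm⟩ := List.exists_top_or_descent r fun ⟨l', h, h'⟩ =>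
    hB (CliffordModel.mem_basisDiwords_iff.2 ⟨y, l', h, by rw [h']⟩)
  exact exists_rightNormedDiword (isLeadingTerm_right A hm) y r₁ r₂

theorem exists_leftNormed_rule {t : Diword (WithTop (Fin n))} (ht : t.right = [])
    (hB : t ∉ CliffordModel.leftDiwords n) :
    ∃ s ∈ gsRelations A, ∃ (c : DiContext (WithTop (Fin n))) (v : Diword (WithTop (Fin n))),
      IsLeadingTerm s v ∧ c.LeftNormedDiword s ∧ c.plug v = t := by
  obtain ⟨l, y, r⟩ := t
  obtain rfl : r = [] := ht
  obtain ⟨r₁, m, r₂, rfl, hm⟩ := List.exists_top_or_descent l fun ⟨l', h, h'⟩ =>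
    hB ⟨y, l', h, by rw [h']⟩
  exact exists_leftNormedDiword (isLeadingTerm_left A hm) y r₁ r₂

/-- If a letter `z` stands just before the center `y`, then `zẏ` is the leading term of relation 2,
8 or 1, according to which of the letters is `e`. As the center lies inside this factor, no
normedness is needed. -/
theorem exists_normal_rule {t : Diword (WithTop (Fin n))} (hB : t ∉ basisDiwords n) :
    ∃ s ∈ gsRelations A, ∃ (c : DiContext (WithTop (Fin n))) (v : Diword (WithTop (Fin n))),
      IsLeadingTerm s v ∧ c.Normal s ∧ c.plug v = t := by
  by_cases ht : t.left = []
  · obtain ⟨s, hs, c, v, hv, hc, h⟩ := exists_rightNormed_rule A ht hB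
    exact ⟨s, hs, c, v, hv, hc.1, h⟩
  obtain ⟨l, y, r⟩ := t
  obtain ⟨a, z, rfl⟩ := l.eq_nil_or_concat'.resolve_left ht
  have key : ∃ s ∈ gsRelations A, IsLeadingTerm s ⟨[z], y, []⟩ := by
    cases z with
    | top =>
      obtain ⟨s, hs, h, -⟩ := isLeadingTerm_left A (Or.inl rfl) y
      exact ⟨s, hs, h⟩
    | coe i =>
      cases y with
      | top => exact isLeadingTerm_r8 A i
      | coe j => exact isLeadingTerm_r1 A i j
  obtain ⟨s, hs, h⟩ := key
  exact ⟨s, hs, .mid a r, _, h, trivial, rfl⟩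

end Reduction

end CliffordDialgebra

namespace DialgebraIdeal

variable {k D : Type*} [Field k] [AddCommGroup D] [Module k D] [DialgebraOps D]

theorem subset_span {S : Set D} {f : D} (hf : f ∈ S) : f ∈ (span k S).toSubmodule := by
  change f ∈ (iInf _ : Submodule k D)
  simp only [Submodule.mem_iInf]
  exact fun I hI => hI hf

theorem span_le {S : Set D} {I : DialgebraIdeal k D} (h : ∀ f ∈ S, f ∈ I.toSubmodule) :
    (span k S).toSubmodule ≤ I.toSubmodule :=
  iInf₂_le I h

theorem toSubmodule_injective :
    Function.Injective (toSubmodule : DialgebraIdeal k D → Submodule k D) := by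
  rintro ⟨I, _, _, _, _⟩ ⟨J, _, _, _, _⟩ h
  obtain rfl : I = J := h
  rfl

end DialgebraIdeal

/-! ### The relations of `S` hold in the Clifford dialgebra. -/

namespace CliffordDialgebra

theorem eq_of_two_smul {k D : Type*} [Field k] [AddCommGroup D] [Module k D]
    (h2 : (2 : k) ≠ 0) {a b : D} {t : k}
    (h : a + a = (2 * t) • b) :
    a = t • b := by
  rw [← two_smul k a, mul_smul] at h
  exact (smul_right_injective D h2) h

section Identities

variable {k D : Type*} [Field k] [AddCommGroup D] [Module k D] [DialgebraOps D]
  [IsDialgebra k D] {ι : Type*} {A : Matrix ι ι k} {x : ι → D} {e y : D}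

open IsDialgebra

/-- Apply `y ⊣` to relation 1: to the right of `⊣` the two products are indistinguishable. -/
theorem dashv_dashv_add (h1 : ∀ i j, x i ⊢ᵈ x j + x j ⊣ᵈ x i = (2 * A i j) • e)
    (hy : y ⊣ᵈ e = y) (i j : ι) :
    y ⊣ᵈ x i ⊣ᵈ x j + y ⊣ᵈ x j ⊣ᵈ x i = (2 * A i j) • y := by
  have h := congrArg (fun z => y ⊣ᵈ z) (h1 i j)
  simp only [dashv_add (k := k), dashv_smul (k := k), hy, dashv_vdash (k := k),
    ← dashv_assoc (k := k)] at h
  exact h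

theorem vdash_vdash_add (h1 : ∀ i j, x i ⊢ᵈ x j + x j ⊣ᵈ x i = (2 * A i j) • e)
    (hy : e ⊢ᵈ y = y) (i j : ι) :
    x i ⊢ᵈ x j ⊢ᵈ y + x j ⊢ᵈ x i ⊢ᵈ y = (2 * A i j) • y := by
  have h := congrArg (fun z => z ⊢ᵈ y) (h1 i j)
  simp only [add_vdash (k := k), smul_vdash (k := k), hy, dashv_vdash' (k := k),
    ← vdash_assoc (k := k)] at h
  exact h

/-- Expand `x_i ⊢ x_j ⊢ x_l` by relation 1 twice and symmetrize in `i, j`. Both the left side and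
the cubic terms in `⊣` sum to `2 a_{ij} x_l`, so they cancel. What remains is a linear relation
between the defects `x_i ⊢ e - e ⊣ x_i` and `x_j ⊢ e - e ⊣ x_j`, with coefficients `2 a_{jl}` and `2
a_{il}`. -/
theorem vdash_eq_dashv (h2 : (2 : k) ≠ 0) (hA0 : A ≠ 0)
    (h1 : ∀ i j, x i ⊢ᵈ x j + x j ⊣ᵈ x i = (2 * A i j) • e)
    (hr : ∀ i, x i ⊣ᵈ e = x i) (hl : ∀ i, e ⊢ᵈ x i = x i) (i : ι) :
    x i ⊢ᵈ e = e ⊣ᵈ x i := by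
  have key : ∀ i j l, (2 * A j l) • (x i ⊢ᵈ e - e ⊣ᵈ x i) +
      (2 * A i l) • (x j ⊢ᵈ e - e ⊣ᵈ x j) = 0 := by
    have h1' : ∀ i j, x i ⊢ᵈ x j = (2 * A i j) • e - x j ⊣ᵈ x i :=
      fun i j => eq_sub_of_add_eq (h1 i j)
    have sub_dashv : ∀ a b c : D, (a - b) ⊣ᵈ c = a ⊣ᵈ c - b ⊣ᵈ c := fun a b c => by
      rw [eq_sub_iff_add_eq, ← add_dashv (k := k), sub_add_cancel]
    have vdash_sub : ∀ a b c : D, a ⊢ᵈ (b - c) = a ⊢ᵈ b - a ⊢ᵈ c := fun a b c => by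
      rw [eq_sub_iff_add_eq, ← vdash_add (k := k), sub_add_cancel]
    have expand : ∀ i j l, x i ⊢ᵈ x j ⊢ᵈ x l = (2 * A j l) • (x i ⊢ᵈ e) -
        ((2 * A i l) • (e ⊣ᵈ x j) - x l ⊣ᵈ x i ⊣ᵈ x j) := fun i j l => by
      rw [vdash_assoc (k := k), h1' j l, vdash_sub, vdash_smul (k := k), vdash_dashv (k := k),
        h1' i l, sub_dashv, smul_dashv (k := k)]
    intro i j l
    have h6 := vdash_vdash_add h1 (hl l) i j
    have h4 := dashv_dashv_add h1 (hr l) i j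
    rw [expand, expand, ← h4] at h6
    rw [← sub_eq_zero] at h6
    rw [← h6]
    module
  have double : ∀ (t : k) (v : D), t ≠ 0 → (2 * t) • v = 0 → v = 0 := fun t v ht h =>
    (smul_eq_zero.1 h).resolve_left (mul_ne_zero h2 ht)
  rw [← sub_eq_zero]
  by_cases hi : ∃ l, A i l ≠ 0
  -- Taking `j = i` multiplies the defect by `4 a_{il}`.
  · obtain ⟨l, hl⟩ := hi
    refine double (2 * A i l) _ (mul_ne_zero h2 hl) ?_
    rw [two_mul, add_smul]
    exact key i i l
  -- If row `i` vanishes, any nonzero entry `a_{jl}` isolates the defect of `x_i`.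
  · push Not at hi
    obtain ⟨j, l, hjl⟩ : ∃ j l, A j l ≠ 0 := by
      by_contra! h
      exact hA0 (Matrix.ext h)
    have := key i j l
    rw [hi l, mul_zero, zero_smul, add_zero] at this
    exact double _ _ hjl this

end Identities

open FreeDialgebra

variable {k : Type*} [Field k] {n : ℕ}

theorem gsRelations_subset_span (h2 : (2 : k) ≠ 0) {A : Matrix (Fin n) (Fin n) k}
    (hA0 : A ≠ 0) {f : FreeDialgebra k (WithTop (Fin n))} (hf : f ∈ gsRelations A) :
    f ∈ (DialgebraIdeal.span k (defRelations A)).toSubmodule := by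
  set I := DialgebraIdeal.span k (defRelations A)
  let q : FreeDialgebra k (WithTop (Fin n)) → FreeDialgebra k (WithTop (Fin n)) ⧸ I.toSubmodule :=
    Submodule.Quotient.mk
  have q0 : ∀ {f}, DefRel A f → q f = 0 := fun hf =>
    (Submodule.Quotient.mk_eq_zero _).2 (DialgebraIdeal.subset_span hf)
  have h1 : ∀ i j, q (x k i) ⊢ᵈ q (x k j) + q (x k j) ⊣ᵈ q (x k i) = (2 * A i j) • q (e k n) :=
    fun i j => sub_eq_zero.1 (q0 (.r1 i j))
  have hl : ∀ y, q (e k n) ⊢ᵈ q (of k y) = q (of k y) := fun y => sub_eq_zero.1 (q0 (.r2 y))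
  have hr : ∀ y, q (of k y) ⊣ᵈ q (e k n) = q (of k y) := fun y => sub_eq_zero.1 (q0 (.r3 y))
  rw [← Submodule.Quotient.mk_eq_zero]
  change q f = 0
  cases hf with
  | r1 i j => exact q0 (.r1 i j)
  | r2 y => exact q0 (.r2 y)
  | r3 y => exact q0 (.r3 y)
  | r4 y i j hij => exact sub_eq_zero.2 (dashv_dashv_add h1 (hr y) i j)
  | r5 y i => exact sub_eq_zero.2 (eq_of_two_smul h2 (dashv_dashv_add h1 (hr y) i i))
  | r6 y i j hij => exact sub_eq_zero.2 (vdash_vdash_add h1 (hl y) i j)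
  | r7 y i => exact sub_eq_zero.2 (eq_of_two_smul h2 (vdash_vdash_add h1 (hl y) i i))
  | r8 i => exact sub_eq_zero.2 (vdash_eq_dashv h2 hA0 h1 (fun i => hr i) (fun i => hl i) i)

theorem span_gsRelations (h2 : (2 : k) ≠ 0) {A : Matrix (Fin n) (Fin n) k} (hA0 : A ≠ 0) :
    DialgebraIdeal.span k (gsRelations A) = DialgebraIdeal.span k (defRelations A) := by
  refine DialgebraIdeal.toSubmodule_injective (le_antisymm
    (DialgebraIdeal.span_le fun f hf => gsRelations_subset_span h2 hA0 hf)
    (DialgebraIdeal.span_le fun f hf => DialgebraIdeal.subset_span ?_))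
  cases hf with
  | r1 i j => exact .r1 i j
  | r2 y => exact .r2 y
  | r3 y => exact .r3 y

theorem span_defRelations_le_ker {A : Matrix (Fin n) (Fin n) k} (hA : A.IsSymm) :
    (DialgebraIdeal.span k (defRelations A)).toSubmodule ≤ LinearMap.ker (CliffordModel.hom A) := by
  refine DialgebraIdeal.span_le (I := CliffordModel.kerIdeal A) fun f hf => ?_
  change CliffordModel.hom A f = 0
  cases hf with
  | r1 i j =>
    rw [map_sub, map_add, CliffordModel.hom_vdash, CliffordModel.hom_dashv, map_smul]
    simp only [x, e, CliffordModel.hom_of]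
    exact CliffordModel.letter_vdash_letter hA i j
  | r2 y =>
    rw [map_sub, CliffordModel.hom_vdash, e, CliffordModel.hom_of, CliffordModel.top_vdash,
      sub_self]
  | r3 y =>
    rw [map_sub, CliffordModel.hom_dashv, e, CliffordModel.hom_of, CliffordModel.hom_of,
      CliffordModel.dashv_top, sub_self]

theorem hom_eval_eq_zero (h2 : (2 : k) ≠ 0) {A : Matrix (Fin n) (Fin n) k} (hA : A.IsSymm)
    (hA0 : A ≠ 0) {s : FreeDialgebra k (WithTop (Fin n))} (hs : s ∈ gsRelations A)
    (c : DiContext (WithTop (Fin n))) : CliffordModel.hom A (c.eval s) = 0 :=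
  (CliffordModel.kerIdeal A).eval_mem c
    (span_defRelations_le_ker hA (gsRelations_subset_span h2 hA0 hs))

/-! ### Triviality of the compositions. -/

section Combinations

variable {A : Matrix (Fin n) (Fin n) k} {h : FreeDialgebra k (WithTop (Fin n))}
  {P : DiContext (WithTop (Fin n)) → FreeDialgebra k (WithTop (Fin n)) →
    Diword (WithTop (Fin n)) → Prop}

theorem isCombination_of_rightNormed (h2 : (2 : k) ≠ 0) (hA : A.IsSymm) (hA0 : A ≠ 0)
    (h0 : CliffordModel.hom A h = 0) (hN : RightNormed h)
    (hP : ∀ c s v, c.RightNormedDiword s → (∃ z ∈ h.support, v ≤ z) → P c s v) :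
    IsCombination (gsRelations A) P h :=
  isCombination_of_map_eq_zero (N := {t | t.left = []}) (Q := DiContext.RightNormedDiword)
    (fun _ hs => monic_of_mem A hs) (fun _ _ hc => ⟨hc.1, hc.2.2⟩)
    (fun _ ht hB => exists_rightNormed_rule A ht hB) (CliffordModel.hom A)
    (fun _ hs c => hom_eval_eq_zero h2 hA hA0 hs c) (CliffordModel.linearIndepOn_basisDiwords A)
    hN h0 hP

/-- Relations 1 and 8 are not left normed, so reduction here uses only 2, 6 and 7. The irreducibles
are therefore `leftDiwords` instead of `basisDiwords`. -/
theorem isCombination_of_leftNormed (h2 : (2 : k) ≠ 0) (hA : A.IsSymm) (hA0 : A ≠ 0)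
    (h0 : CliffordModel.hom A h = 0) (hN : LeftNormed h)
    (hP : ∀ c s v, c.LeftNormedDiword s → (∃ z ∈ h.support, v ≤ z) → P c s v) :
    IsCombination (gsRelations A) P h :=
  isCombination_of_map_eq_zero (N := {t | t.right = []}) (Q := DiContext.LeftNormedDiword)
    (fun _ hs => monic_of_mem A hs) (fun _ _ hc => ⟨hc.1, hc.2.2⟩)
    (fun _ ht hB => exists_leftNormed_rule A ht hB) (CliffordModel.hom A)
    (fun _ hs c => hom_eval_eq_zero h2 hA hA0 hs c) (CliffordModel.linearIndepOn_leftDiwords A)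
    hN h0 hP

theorem isCombination_of_normal (h2 : (2 : k) ≠ 0) (hA : A.IsSymm) (hA0 : A ≠ 0)
    (h0 : CliffordModel.hom A h = 0)
    (hP : ∀ c s v, c.Normal s → (∃ z ∈ h.support, v ≤ z) → P c s v) :
    IsCombination (gsRelations A) P h :=
  isCombination_of_map_eq_zero (N := Set.univ) (Q := DiContext.Normal)
    (fun _ hs => monic_of_mem A hs) (fun _ _ hc => ⟨hc, fun _ _ => trivial⟩)
    (fun _ _ hB => exists_normal_rule A hB) (CliffordModel.hom A)
    (fun _ hs c => hom_eval_eq_zero h2 hA hA0 hs c) (CliffordModel.linearIndepOn_basisDiwords A)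
    (fun _ _ => trivial) h0 hP

end Combinations

theorem exists_isLeadingTerm_length_le {X : Type*} [LinearOrder X] {h : FreeDialgebra k X}
    {v : Diword X} (hv : ∃ z ∈ h.support, v ≤ z) :
    ∃ u, IsLeadingTerm h u ∧ v.length ≤ u.length := by
  obtain ⟨z, hz, hvz⟩ := hv
  obtain ⟨u, hu⟩ := exists_isLeadingTerm (Finsupp.support_nonempty_iff.1 ⟨z, hz⟩)
  exact ⟨u, hu, Diword.length_le_of_le (hvz.trans (hu.2 z hz))⟩

/-- Inclusion and intersection are treated alike: all that matters is that two normal diwords share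
the leading term `w`. The three cases choose the class of diwords in which to reduce, so that the
required normedness is inherited. -/
theorem compositionTrivial (h2 : (2 : k) ≠ 0) {A : Matrix (Fin n) (Fin n) k} (hA : A.IsSymm)
    (hA0 : A ≠ 0) {f g : FreeDialgebra k (WithTop (Fin n))} (hf : f ∈ gsRelations A)
    (hg : g ∈ gsRelations A) {u v w : Diword (WithTop (Fin n))}
    {c d : DiContext (WithTop (Fin n))} (hu : IsLeadingTerm f u) (hv : IsLeadingTerm g v)
    (hc : c.Normal f) (hd : d.Normal g) (hw : w = c.plug u) (hw' : w = d.plug v) :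
    CompositionTrivial (gsRelations A) w c f d g := by
  classical
  subst hw
  have h0 : CliffordModel.hom A (c.eval f - d.eval g) = 0 := by
    rw [map_sub, hom_eval_eq_zero h2 hA hA0 hf, hom_eval_eq_zero h2 hA hA0 hg, sub_zero]
  have hlt : ∀ {t}, (∃ z ∈ (c.eval f - d.eval g).support, t ≤ z) → t < c.plug u :=
    fun ⟨z, hz, htz⟩ => htz.trans_lt
      (lt_of_mem_support_eval_sub hu hv (monic_of_mem A hf) (monic_of_mem A hg) hc hd hw' hz)
  by_cases hR : c.RightNormedDiword f ∧ d.RightNormedDiword g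
  · refine isCombination_of_rightNormed h2 hA hA0 h0 ?_ fun e s t he ht => ⟨he.1, hlt ht,
      fun _ _ => he, fun hl _ => (not_leftNormed_and_rightNormed A hf hl.2.1 hR.1.2.1).elim⟩
    intro z hz
    rcases Finset.mem_union.1 (Finsupp.support_sub hz) with hz | hz
    exacts [hR.1.2.2 z hz, hR.2.2.2 z hz]
  by_cases hL : c.LeftNormedDiword f ∧ d.LeftNormedDiword g
  · refine isCombination_of_leftNormed h2 hA hA0 h0 ?_ fun e s t he ht => ⟨he.1, hlt ht,
      fun h h' => (hR ⟨h, h'⟩).elim, fun _ _ => he⟩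
    intro z hz
    rcases Finset.mem_union.1 (Finsupp.support_sub hz) with hz | hz
    exacts [hL.1.2.2 z hz, hL.2.2.2 z hz]
  · exact isCombination_of_normal h2 hA hA0 h0 fun e s t he ht => ⟨he, hlt ht,
      fun h h' => (hR ⟨h, h'⟩).elim, fun h h' => (hL ⟨h, h'⟩).elim⟩

theorem isGroebnerShirshovBasis (h2 : (2 : k) ≠ 0) {A : Matrix (Fin n) (Fin n) k}
    (hA : A.IsSymm) (hA0 : A ≠ 0) : IsGroebnerShirshovBasis (gsRelations A) where
  monic f hf := monic_of_mem A hf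
  left_mul f hf _ y := by
    have h0 : CliffordModel.hom A (of k y ⊣ᵈ f) = 0 :=
      (CliffordModel.kerIdeal A).dashv_mem_left _
        (span_defRelations_le_ker hA (gsRelations_subset_span h2 hA0 hf))
    refine isCombination_of_rightNormed h2 hA hA0 h0 ?_ fun c s v hc hv =>
      ⟨hc, exists_isLeadingTerm_length_le hv⟩
    intro u hu
    -- All diwords of `y ⊣ f` have center `y` in first position, so the product is right normed
    -- whatever `f` is.
    have e : of k y ⊣ᵈ f = (DiContext.post (Diword.letter y) []).eval f := rfl
    rw [e] at hu
    obtain ⟨v, -, rfl⟩ := DiContext.exists_of_mem_support_eval hu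
    rfl
  right_mul f hf _ y := by
    have h0 : CliffordModel.hom A (f ⊢ᵈ of k y) = 0 :=
      (CliffordModel.kerIdeal A).vdash_mem_right _
        (span_defRelations_le_ker hA (gsRelations_subset_span h2 hA0 hf))
    refine isCombination_of_leftNormed h2 hA hA0 h0 ?_ fun c s v hc hv =>
      ⟨hc, exists_isLeadingTerm_length_le hv⟩
    intro u hu
    have e : f ⊢ᵈ of k y = (DiContext.pre [] (Diword.letter y)).eval f := rfl
    rw [e] at hu
    obtain ⟨v, -, rfl⟩ := DiContext.exists_of_mem_support_eval hu
    rfl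
  inclusion f hf g hg u v w d hu hv hd hw hw' :=
    compositionTrivial h2 hA hA0 hf hg hu hv trivial hd (by simp [hw, DiContext.plug]) hw'
  intersection f hf g hg u v w c d hu hv _ _ hc hd hw hw' _ :=
    compositionTrivial h2 hA hA0 hf hg hu hv hc hd hw hw'

/-! ### The linear basis of the Clifford dialgebra. -/

theorem linearIndependent_mk_basisDiwords {A : Matrix (Fin n) (Fin n) k} (hA : A.IsSymm) :
    LinearIndependent k fun u : basisDiwords n => (Submodule.Quotient.mk
      (Finsupp.single (u : Diword (WithTop (Fin n))) 1 : FreeDialgebra k (WithTop (Fin n))) :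
        CliffordDialgebra A) :=
  LinearIndependent.of_comp (Submodule.liftQ _ _ (span_defRelations_le_ker hA))
    (CliffordModel.linearIndepOn_basisDiwords A)

/-- Reduction rewrites each diword as a combination of `S`-diwords, which vanish in the quotient,
and of irreducible ones. -/
theorem span_mk_basisDiwords (h2 : (2 : k) ≠ 0) {A : Matrix (Fin n) (Fin n) k} (hA0 : A ≠ 0) :
    ⊤ ≤ Submodule.span k (Set.range fun u : basisDiwords n => (Submodule.Quotient.mk
      (Finsupp.single (u : Diword (WithTop (Fin n))) 1 : FreeDialgebra k (WithTop (Fin n))) :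
        CliffordDialgebra A)) := by
  set T := Submodule.span k (Set.range fun u : basisDiwords n => (Submodule.Quotient.mk
      (Finsupp.single (u : Diword (WithTop (Fin n))) 1 : FreeDialgebra k (WithTop (Fin n))) :
        CliffordDialgebra A))
  let q := Submodule.mkQ (DialgebraIdeal.span k (defRelations A)).toSubmodule
  suffices h : ∀ t, Finsupp.single t 1 ∈ T.comap q by
    rintro z -
    obtain ⟨f, rfl⟩ := Submodule.mkQ_surjective _ z
    change f ∈ T.comap q
    rw [← Finsupp.sum_single f]
    refine Submodule.sum_mem _ fun t _ => ?_
    simpa using Submodule.smul_mem _ (f t) (h t)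
  intro t
  have hle : Submodule.span k {g | ∃ t' ≤ t, g ∈ rules (gsRelations A) DiContext.Normal t'} ⊔
      Finsupp.supported k k (basisDiwords n) ≤ T.comap q := by
    refine sup_le (Submodule.span_le.2 ?_) ?_
    · rintro _ ⟨_, -, s, hs, c, v, -, -, -, rfl⟩
      have : q (c.eval s) = 0 := (Submodule.Quotient.mk_eq_zero _).2
        ((DialgebraIdeal.span k (defRelations A)).eval_mem c (gsRelations_subset_span h2 hA0 hs))
      change q (c.eval s) ∈ T
      rw [this]
      exact T.zero_mem
    · rw [Finsupp.supported_eq_span_single]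
      refine Submodule.span_le.2 ?_
      rintro _ ⟨u, hu, rfl⟩
      exact Submodule.subset_span ⟨⟨u, hu⟩, rfl⟩
  exact hle (single_mem_span_sup_supported (N := Set.univ)
    (exists_mem_rules (fun _ hs => monic_of_mem A hs) (fun _ _ hc => ⟨hc, fun _ _ => trivial⟩)
      (fun _ _ hB => exists_normal_rule A hB)) t trivial)

end CliffordDialgebra

theorem mainTheorem6 {k : Type*} [Field k] (hk : ringChar k ≠ 2) {n : ℕ}
    (A : Matrix (Fin n) (Fin n) k) (hA : A.IsSymm) (hA0 : A ≠ 0) :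
    (FreeDialgebra.IsGroebnerShirshovBasis (CliffordDialgebra.gsRelations A) ∧
      DialgebraIdeal.span k (CliffordDialgebra.gsRelations A) =
        DialgebraIdeal.span k (CliffordDialgebra.defRelations A)) ∧
    ∃ B : Module.Basis (CliffordDialgebra.basisDiwords n) k (CliffordDialgebra A),
      ∀ u : CliffordDialgebra.basisDiwords n,
        B u = Submodule.Quotient.mk
          (Finsupp.single (u : Diword (WithTop (Fin n))) 1 :
            FreeDialgebra k (WithTop (Fin n))) := by
  have h2 : (2 : k) ≠ 0 := Ring.two_ne_zero hk
  exact ⟨⟨CliffordDialgebra.isGroebnerShirshovBasis h2 hA hA0,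
      CliffordDialgebra.span_gsRelations h2 hA0⟩,
    .mk (CliffordDialgebra.linearIndependent_mk_basisDiwords hA)
      (CliffordDialgebra.span_mk_basisDiwords h2 hA0),
    fun u => Module.Basis.mk_apply _ _ u⟩
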